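/- Let $d,\alpha\ge 1$ be integers, let $\sigma\in\mathbb N$ with $\sigma>d/2$, and put $p=1+2\alpha$. Let $\gamma_+,\gamma_->0$, $t_+\in(0,1)$, and let $\gamma:\mathbb R\to\mathbb R$ be the $1$-periodic function with $\gamma=\gamma_+$ on $(0,t_+]$ and $\gamma=-\gamma_-$ on $(t_+,1]$; write $\langle\gamma\rangle=\int_0^1\gamma(\tau)\,d\tau$. Let $t_0\in\mathbb R$ and $\varphi\in H^\sigma(\mathbb R^d)$ (complex valued). Consider, for $\varepsilon>0$, the dispersion managed equation $$ i\partial_t u_\varepsilon+\gamma\!\left(\tfrac t\varepsilon\right)\Delta u_\varepsilon+|u_\varepsilon|^{p-1}u_\varepsilon=0,\qquad u_\varepsilon(t_0)=\varphi, $$ and the averaged equation $$ i\partial_t u_0+\langle\gamma\rangle\Delta u_0+|u_0|^{p-1}u_0=0,\qquad u_0(t_0)=\varphi. $$ For $g(t)=\gamma(t/\varepsilon)$ or $g(t)=\langle\gamma\rangle$, an $H^\sigma$ solution on an interval $J$ with left end point $t_0\in J$ is a function $u\in C(J,H^\sigma(\mathbb R^d))$ with $$u(t)=U(t,t_0)\varphi+i\int_{t_0}^tU(t,s)\,|u(s)|^{p-1}u(s)\,ds\quad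 (t\in J),\qquad U(t,s)=e^{i\left(\int_s^t g(\tau)\,d\tau\right)\Delta}.$$ A maximal solution is an $H^\sigma$ solution on $[t_0,T_{\max})$, $t_0<T_{\max}\le\infty$, such that $\lim_{t\uparrow T_{\max}}\|u(t)\|_{H^\sigma}=\infty$ if $T_{\max}<\infty$. Then the averaged equation and, for every $\varepsilon>0$, the dispersion managed equation have a maximal solution, and it is unique in the sense that every $H^\sigma$ solution on a compact interval $[t_0,T]$, $T>t_0$, satisfies $T<T_{\max}$ and is the restriction of the maximal solution. Let $u_0$ on $[t_0,T_*)$ and $u_\varepsilon$ on $[t_0,T^\varepsilon)$ denote these maximal solutions. For every $T$ with $t_0<T<T_*$ one has $T<T^\varepsilon$ for all sufficiently small $\varepsilon>0$, and $$\lim_{\varepsilon\to0_+}\ \sup_{t\in[t_0,T]}\|u_\varepsilon(t)-u_0(t)\|_{H^\sigma(\mathbb R^d)}=0,$$ that is, $u_\varepsilon\to u_0$ in $L^\infty([t_0,T],H^\sigma(\mathbb R^d))$ as $\varepsilon\to0_+$. -/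

import Mathlib

open MeasureTheory Filter Topology Set FourierTransform
open scoped ENNReal SchwartzMap

noncomputable section

/-- The space `L²(ℝᵈ; ℂ)`. -/
abbrev L2 (d : ℕ) : Type :=
  Lp ℂ 2 (volume : Measure (EuclideanSpace ℝ (Fin d)))

/-- `f ∈ L²(ℝᵈ)` belongs to the Sobolev space `H^s(ℝᵈ)`. -/
def MemHs {d : ℕ} (s : ℝ) (f : L2 d) : Prop :=
  TemperedDistribution.MemSobolev s 2 (f : 𝓢'(EuclideanSpace ℝ (Fin d), ℂ))

/-- The Sobolev norm `‖f‖_{H^s} = (∫ (1 + 4π²|ξ|²)^s |𝓕 f(ξ)|² dξ)^{1/2}`, with value `∞` for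
`f ∉ H^s`. As `𝓕 f(ξ) = ∫ e^{-2πi x·ξ} f(x) dx`, the weight is the symbol of `(1 - Δ)^{s/2}`. -/
def hsNorm {d : ℕ} (s : ℝ) (f : L2 d) : ℝ≥0∞ :=
  eLpNorm (fun ξ : EuclideanSpace ℝ (Fin d) =>
    (((1 + 4 * Real.pi ^ 2 * ‖ξ‖ ^ 2) ^ (s / 2) : ℝ) : ℂ) * (𝓕 f : L2 d) ξ) 2 volume

/-- The symbol of `e^{iθΔ}`, as a bounded function. -/
theorem memLp_schrodingerSymbol (d : ℕ) (θ : ℝ) :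
    MemLp (fun ξ : EuclideanSpace ℝ (Fin d) =>
      Complex.exp (-(Complex.I * ((θ * (4 * Real.pi ^ 2 * ‖ξ‖ ^ 2) : ℝ) : ℂ)))) ∞ volume := by
  refine memLp_top_of_bound (Continuous.aestronglyMeasurable (by fun_prop)) 1
    (Eventually.of_forall fun ξ => ?_)
  simp only [Complex.norm_exp, Complex.neg_re, Complex.I_mul_re, Complex.ofReal_im, neg_zero,
    Real.exp_zero, le_refl]

/-- The unitary operator `e^{iθΔ}` on `L²(ℝᵈ)`, i.e. the Fourier multiplier
`e^{-iθ·4π²|ξ|²}`. -/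
def schrodingerOp {d : ℕ} (θ : ℝ) (f : L2 d) : L2 d :=
  𝓕⁻ ((memLp_schrodingerSymbol d θ).toLp _ • (𝓕 f : L2 d) : L2 d)

open Classical in
/-- The nonlinearity `|u|^{p-1} u` with `p = 1 + 2α`, as a map into `L²`. It is given the value `0`
if `|u|^{2α} u` is not in `L²`, which does not occur for `u ∈ H^σ` with `σ > d/2`. -/
def powerNL {d : ℕ} (α : ℕ) (u : L2 d) : L2 d :=
  if h : MemLp (fun x => ((‖u x‖ ^ (2 * α) : ℝ) : ℂ) * u x) 2
      (volume : Measure (EuclideanSpace ℝ (Fin d))) then h.toLp _ else 0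

/-- The `1`-periodic dispersion map with value `γp` on `(0, tp]` and `-γm` on `(tp, 1]`; here
`τ - ⌈τ⌉ + 1` is the representative of `τ` modulo `1` in `(0, 1]`. -/
def dispersionMap (γp γm tp τ : ℝ) : ℝ :=
  if τ - ⌈τ⌉ + 1 ≤ tp then γp else -γm

/-- The average `⟨γ⟩ = ∫₀¹ γ(τ) dτ`. -/
def averageDispersion (γ : ℝ → ℝ) : ℝ := ∫ τ in (0 : ℝ)..1, γ τ

/-- `u` is an `H^σ` solution on the time interval `J` (with left end point `t₀`) of
`i ∂ₜu + g(t) Δu + |u|^{2α} u = 0`, `u(t₀) = φ`: it is continuous on `J` with values in `H^σ` and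
satisfies Duhamel's formula
`u(t) = U(t,t₀) φ + i ∫_{t₀}^t U(t,s) |u(s)|^{2α} u(s) ds` with `U(t,s) = exp(i (∫_s^t g) Δ)`. -/
structure IsNLSSolution {d : ℕ} (σ α : ℕ) (g : ℝ → ℝ) (t₀ : ℝ) (φ : L2 d) (J : Set ℝ)
    (u : ℝ → L2 d) : Prop where
  mem : ∀ t ∈ J, MemHs σ (u t)
  cont : ∀ t ∈ J, Tendsto (fun s => hsNorm σ (u s - u t)) (𝓝[J] t) (𝓝 0)
  duhamel : ∀ t ∈ J, u t = schrodingerOp (∫ τ in t₀..t, g τ) φ +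
    Complex.I • ∫ s in t₀..t, schrodingerOp (∫ τ in s..t, g τ) (powerNL α (u s))

/-- `u` is a maximal `H^σ` solution, with existence interval `[t₀, Tmax)`: if `Tmax < ∞`, then
`‖u(t)‖_{H^σ} → ∞` as `t ↑ Tmax`. -/
structure IsMaximalNLSSolution {d : ℕ} (σ α : ℕ) (g : ℝ → ℝ) (t₀ : ℝ) (φ : L2 d)
    (Tmax : EReal) (u : ℝ → L2 d) : Prop where
  lt : (t₀ : EReal) < Tmax
  isSolution : IsNLSSolution σ α g t₀ φ {t : ℝ | t₀ ≤ t ∧ (t : EReal) < Tmax} u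
  blowup : ∀ T : ℝ, Tmax = (T : EReal) → Tendsto (fun t => hsNorm σ (u t)) (𝓝[<] T) (𝓝 ∞)

/-- There is a maximal `H^σ` solution, and every `H^σ` solution on a compact interval `[t₀, T]` is
a restriction of it. In particular its `Tmax` is the maximal time of existence in `H^σ`. -/
def HasUniqueMaximalNLSSolution {d : ℕ} (σ α : ℕ) (g : ℝ → ℝ) (t₀ : ℝ) (φ : L2 d) : Prop :=
  ∃ (Tmax : EReal) (u : ℝ → L2 d), IsMaximalNLSSolution σ α g t₀ φ Tmax u ∧
    ∀ (T : ℝ) (v : ℝ → L2 d), t₀ < T → IsNLSSolution σ α g t₀ φ (Icc t₀ T) v →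
      (T : EReal) < Tmax ∧ EqOn v u (Icc t₀ T)

end

/-! The dispersion enters only through its primitive θ(t) = ∫_{t₀}^t g. Identify H^σ with L² by
dividing by the Bessel weight on the Fourier side (`sobolevEmb`) and remove the free flow, writing
u(t) = `sobolevEmb` (S(θ(t)) b(t)) with S = `schrodingerMul`. By `integral_duhamel_eq`, Duhamel's
formula becomes b(t) = a₀ + ∫ F(θ(s), b(s)) ds with F(r, x) = i S(-r) N(S(r) x)
(`interactionField`), where N is the power nonlinearity read in L². Here θ is continuous although γ
jumps. Since σ > d/2, H^σ is an algebra, so N is Lipschitz on balls (`exists_powerNL_sobolevEmb`);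
since S(r) is an isometry, F(r, ·) is so uniformly in r. The equation is thus an ODE in a Banach
space without unbounded operator, and Picard-Lindelöf gives the unique maximal solution
(`IsUniformLipschitzField.exists_maximal`).

For the limit, γ - ⟨γ⟩ has a periodic, hence bounded, primitive, so θ_ε - θ₀ = O(ε) uniformly in
time (`Function.Periodic.exists_abs_integral_comp_div_sub_le`). S is only strongly continuous, so
this does not make the fields close uniformly on balls. They are close along the compact trajectory
of the averaged solution (`exists_pos_forall_norm_sub_lt`), and this is all that Gronwall's
inequality needs (`IsMaximalIntegralSolution.dist_lt`). The same compactness controls S(θ_ε) - S(θ₀)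
on that trajectory when returning from b to u. -/

/-! ### Integral equations in a Banach space: maximal solutions and stability. -/

section IntegralSolutions

open Metric
open scoped NNReal

variable {X : Type*} [NormedAddCommGroup X] [NormedSpace ℝ X]

/-- `b` is continuous on `J` and solves `b t = x₀ + ∫_{t₀}^t F(s, b s) ds` there. -/
structure IsIntegralSolution (F : ℝ → X → X) (t₀ : ℝ) (x₀ : X) (J : Set ℝ) (b : ℝ → X) :
    Prop where
  cont : ContinuousOn b J
  eq : ∀ t ∈ J, b t = x₀ + ∫ s in t₀..t, F s (b s)

/-- A continuous field, bounded and Lipschitz on balls uniformly in time. -/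
structure IsUniformLipschitzField (F : ℝ → X → X) : Prop where
  cont : Continuous fun p : ℝ × X => F p.1 p.2
  lip : ∀ R : ℝ, ∃ K : ℝ≥0, ∀ t, LipschitzOnWith K (F t) (closedBall 0 R)
  bdd : ∀ R : ℝ, ∃ C : ℝ≥0, ∀ t, ∀ x ∈ closedBall (0 : X) R, ‖F t x‖ ≤ C

namespace IsIntegralSolution

variable {F : ℝ → X → X} {t₀ t₁ T T' : ℝ} {x₀ : X} {J J' : Set ℝ} {b c : ℝ → X}

theorem mono (h : IsIntegralSolution F t₀ x₀ J b) (hJ : J' ⊆ J) :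
    IsIntegralSolution F t₀ x₀ J' b :=
  ⟨h.cont.mono hJ, fun t ht => h.eq t (hJ ht)⟩

theorem apply_left (h : IsIntegralSolution F t₀ x₀ J b) (ht : t₀ ∈ J) : b t₀ = x₀ := by
  simpa using h.eq t₀ ht

theorem congr_Icc (h : IsIntegralSolution F t₀ x₀ (Icc t₀ T) b) (hbc : EqOn c b (Icc t₀ T)) :
    IsIntegralSolution F t₀ x₀ (Icc t₀ T) c := by
  refine ⟨h.cont.congr hbc, fun t ht => ?_⟩
  rw [hbc ht, h.eq t ht]
  congr 1
  refine intervalIntegral.integral_congr fun s hs => ?_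
  rw [uIcc_of_le ht.1] at hs
  simp only [hbc ⟨hs.1, hs.2.trans ht.2⟩]

theorem of_forall_Icc (h : ∀ t ∈ J, t₀ ≤ t)
    (hloc : ∀ t ∈ J, ∃ T, t < T ∧ IsIntegralSolution F t₀ x₀ (Icc t₀ T) b) :
    IsIntegralSolution F t₀ x₀ J b := by
  refine ⟨fun t ht => ?_, fun t ht => ?_⟩
  · obtain ⟨T, htT, hb⟩ := hloc t ht
    have h1 : ContinuousWithinAt b (Icc t₀ T) t := hb.cont t ⟨h t ht, htT.le⟩
    refine h1.mono_of_mem_nhdsWithin ?_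
    filter_upwards [self_mem_nhdsWithin, mem_nhdsWithin_of_mem_nhds (Iio_mem_nhds htT)]
      with s hs hs'
    exact ⟨h s hs, le_of_lt hs'⟩
  · obtain ⟨T, htT, hb⟩ := hloc t ht
    exact hb.eq t ⟨h t ht, htT.le⟩

theorem continuousOn_field (hF : Continuous fun p : ℝ × X => F p.1 p.2)
    (h : IsIntegralSolution F t₀ x₀ J b) : ContinuousOn (fun s => F s (b s)) J :=
  hF.comp_continuousOn (continuousOn_id.prodMk h.cont)

theorem hasDerivWithinAt [CompleteSpace X] (hF : Continuous fun p : ℝ × X => F p.1 p.2)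
    (h : IsIntegralSolution F t₀ x₀ (Icc t₀ T) b) {t : ℝ} (ht : t ∈ Ico t₀ T) :
    HasDerivWithinAt b (F t (b t)) (Ici t) t := by
  have hT : t₀ ≤ T := ht.1.trans ht.2.le
  -- Freezing the integrand outside the interval makes it continuous on ℝ, so the fundamental
  -- theorem of calculus applies at the end point `t₀` too.
  set f : ℝ → X := IccExtend hT ((Icc t₀ T).domRestrict fun s => F s (b s)) with hf
  have hfc : Continuous f := (h.continuousOn_field hF).domRestrict.Icc_extend'
  have hfe : ∀ s ∈ Icc t₀ T, f s = F s (b s) := fun s hs => by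
    rw [hf, IccExtend_of_mem _ _ hs]; rfl
  have hd : HasDerivAt (fun r => x₀ + ∫ s in t₀..r, f s) (F t (b t)) t := by
    rw [← hfe t (Ico_subset_Icc_self ht)]
    exact (hfc.integral_hasStrictDerivAt t₀ t).hasDerivAt.const_add x₀
  have hb : ∀ r ∈ Icc t₀ T, b r = x₀ + ∫ s in t₀..r, f s := fun r hr => by
    rw [h.eq r hr]
    congr 1
    refine intervalIntegral.integral_congr fun s hs => ?_
    rw [uIcc_of_le hr.1] at hs
    exact (hfe s ⟨hs.1, hs.2.trans hr.2⟩).symm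
  refine hd.hasDerivWithinAt.congr_of_eventuallyEq ?_ (hb t (Ico_subset_Icc_self ht))
  filter_upwards [Icc_mem_nhdsGE ht.2] with r hr
  exact hb r ⟨ht.1.trans hr.1, hr.2⟩

theorem exists_norm_le (h : IsIntegralSolution F t₀ x₀ (Icc t₀ T) b) :
    ∃ R : ℝ, ∀ t ∈ Icc t₀ T, ‖b t‖ ≤ R :=
  isCompact_Icc.exists_bound_of_continuousOn h.cont

theorem eqOn [CompleteSpace X] (hF : IsUniformLipschitzField F)
    (hb : IsIntegralSolution F t₀ x₀ (Icc t₀ T) b)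
    (hc : IsIntegralSolution F t₀ x₀ (Icc t₀ T) c) : EqOn b c (Icc t₀ T) := by
  rcases lt_or_ge T t₀ with hT | hT
  · simp [Icc_eq_empty (not_le.mpr hT)]
  obtain ⟨R₁, h₁⟩ := hb.exists_norm_le
  obtain ⟨R₂, h₂⟩ := hc.exists_norm_le
  obtain ⟨K, hK⟩ := hF.lip (max R₁ R₂)
  refine ODE_solution_unique_of_mem_Icc_right (v := F) (s := fun _ => closedBall 0 (max R₁ R₂))
    (K := K) (fun t _ => hK t) hb.cont (fun t ht => hb.hasDerivWithinAt hF.cont ht)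
    (fun t ht => ?_) hc.cont (fun t ht => hc.hasDerivWithinAt hF.cont ht) (fun t ht => ?_) ?_
  · simpa using Or.inl (h₁ t (Ico_subset_Icc_self ht))
  · simpa using Or.inr (h₂ t (Ico_subset_Icc_self ht))
  · rw [hb.apply_left (left_mem_Icc.mpr hT), hc.apply_left (left_mem_Icc.mpr hT)]

open Classical in
-- Used to restart a solution at `t₁` and so prolong it.
theorem append (hF : Continuous fun p : ℝ × X => F p.1 p.2) (h₀ : t₀ ≤ t₁) (h₁ : t₁ ≤ T)
    (hb : IsIntegralSolution F t₀ x₀ (Icc t₀ t₁) b)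
    (hc : IsIntegralSolution F t₁ (b t₁) (Icc t₁ T) c) :
    IsIntegralSolution F t₀ x₀ (Icc t₀ T) (fun t => if t ≤ t₁ then b t else c t) := by
  set u : ℝ → X := fun t => if t ≤ t₁ then b t else c t with hu
  have hub : EqOn u b (Icc t₀ t₁) := fun t ht => by simp [hu, ht.2]
  have huc : EqOn u c (Icc t₁ T) := fun t ht => by
    rcases ht.1.eq_or_lt with rfl | h
    · simp [hu, hc.apply_left (left_mem_Icc.mpr h₁)]
    · simp [hu, not_le.mpr h]
  have hb' := hb.congr_Icc hub
  have hc' := hc.congr_Icc huc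
  refine ⟨?_, fun t ht => ?_⟩
  · rw [← Icc_union_Icc_eq_Icc h₀ h₁]
    exact hb'.cont.union_of_isClosed hc'.cont isClosed_Icc isClosed_Icc
  · rcases le_total t t₁ with h | h
    · exact hb'.eq t ⟨ht.1, h⟩
    · rw [hc'.eq t ⟨h, ht.2⟩, ← hub (right_mem_Icc.mpr h₀), hb'.eq t₁ (right_mem_Icc.mpr h₀),
        add_assoc, intervalIntegral.integral_add_adjacent_intervals]
      · refine ContinuousOn.intervalIntegrable_of_Icc h₀ (hb'.continuousOn_field hF)
      · exact ContinuousOn.intervalIntegrable_of_Icc h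
          ((hc'.continuousOn_field hF).mono (Icc_subset_Icc_right ht.2))

end IsIntegralSolution

/-- The time of existence is bounded below on balls. -/
theorem IsUniformLipschitzField.exists_solution [CompleteSpace X] {F : ℝ → X → X}
    (hF : IsUniformLipschitzField F) (R : ℝ) :
    ∃ τ > 0, ∀ (t₁ : ℝ) (x₁ : X), ‖x₁‖ ≤ R →
      ∃ c, IsIntegralSolution F t₁ x₁ (Icc t₁ (t₁ + τ)) c := by
  obtain ⟨K, hK⟩ := hF.lip (R + 1)
  obtain ⟨C, hC⟩ := hF.bdd (R + 1)
  have hC1 : (0 : ℝ) < C + 1 := by positivity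
  have hτ : (0 : ℝ) < 1 / (C + 1) := by positivity
  -- At speed at most `C` the solution moves by less than 1 in this time, so it stays in the ball of
  -- radius `R + 1` on which `C` and `K` are valid. The `+ 1` covers `C = 0`.
  refine ⟨1 / (C + 1), hτ, fun t₁ x₁ hx => ?_⟩
  have hsub : closedBall x₁ ((1 : ℝ≥0) : ℝ) ⊆ closedBall (0 : X) (R + 1) :=
    closedBall_subset_closedBall' (by simp; linarith)
  have hmem : t₁ ∈ Icc t₁ (t₁ + 1 / (C + 1)) := ⟨le_rfl, by linarith⟩
  have hP : IsPicardLindelof F (⟨t₁, hmem⟩ : Icc t₁ (t₁ + 1 / (C + 1))) x₁ 1 0 C K := by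
    refine ⟨fun t _ => (hK t).mono hsub, fun x _ => ?_, fun t _ x hx => hC t x (hsub hx), ?_⟩
    · exact (hF.cont.comp (by fun_prop : Continuous fun t : ℝ => (t, x))).continuousOn
    · have : (C : ℝ) * (1 / (C + 1)) ≤ 1 := by
        rw [mul_one_div, div_le_one hC1]; linarith
      simpa [hC1.le] using this
  obtain ⟨c, hc0, hc⟩ := hP.exists_eq_forall_mem_Icc_hasDerivWithinAt₀
  have hcont : ContinuousOn c (Icc t₁ (t₁ + 1 / (C + 1))) := fun t ht =>
    (hc t ht).continuousWithinAt
  refine ⟨c, hcont, fun t ht => ?_⟩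
  have hfc : ContinuousOn (fun s => F s (c s)) (Icc t₁ (t₁ + 1 / (C + 1))) :=
    hF.cont.comp_continuousOn (continuousOn_id.prodMk hcont)
  have := intervalIntegral.integral_eq_sub_of_hasDerivAt_of_le ht.1
    (hcont.mono (Icc_subset_Icc_right ht.2)) (f' := fun s => F s (c s)) (fun s hs =>
      (hc s ⟨hs.1.le, hs.2.le.trans ht.2⟩).hasDerivAt (Icc_mem_nhds hs.1 (hs.2.trans_le ht.2)))
    ((hfc.mono (Icc_subset_Icc_right ht.2)).intervalIntegrable_of_Icc ht.1)
  rw [this, show c t₁ = x₁ from hc0]; abel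

/-- `b` is a maximal solution, on `[t₀, Tmax)`: its norm blows up at a finite `Tmax`. -/
structure IsMaximalIntegralSolution (F : ℝ → X → X) (t₀ : ℝ) (x₀ : X) (Tmax : EReal)
    (b : ℝ → X) : Prop where
  lt : (t₀ : EReal) < Tmax
  isSolution : IsIntegralSolution F t₀ x₀ {t : ℝ | t₀ ≤ t ∧ (t : EReal) < Tmax} b
  blowup : ∀ T : ℝ, Tmax = (T : EReal) → Tendsto (fun t => ‖b t‖) (𝓝[<] T) atTop

/-- The existence time is the supremum of the lengths of all local solutions, which uniqueness glues
together. Since the local existence time depends only on a norm bound, failure of the norm to tend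
to infinity at a finite end point would allow a restart across it. -/
theorem IsUniformLipschitzField.exists_maximal [CompleteSpace X] {F : ℝ → X → X}
    (hF : IsUniformLipschitzField F) (t₀ : ℝ) (x₀ : X) :
    ∃ (Tmax : EReal) (u : ℝ → X), IsMaximalIntegralSolution F t₀ x₀ Tmax u ∧
      ∀ (T : ℝ) (v : ℝ → X), t₀ < T → IsIntegralSolution F t₀ x₀ (Icc t₀ T) v →
        (T : EReal) < Tmax ∧ EqOn v u (Icc t₀ T) := by
  classical
  set 𝒯 : Set ℝ := {T | t₀ < T ∧ ∃ b, IsIntegralSolution F t₀ x₀ (Icc t₀ T) b} with h𝒯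
  set Tmax : EReal := sSup ((fun T : ℝ => (T : EReal)) '' 𝒯) with hTmax
  have hextend : ∀ R : ℝ, ∃ τ > 0, ∀ t₁ > t₀, ∀ b, IsIntegralSolution F t₀ x₀ (Icc t₀ t₁) b →
      ‖b t₁‖ ≤ R → t₁ + τ ∈ 𝒯 := by
    intro R
    obtain ⟨τ, hτ, h⟩ := hF.exists_solution R
    refine ⟨τ, hτ, fun t₁ ht₁ b hb hR => ?_⟩
    obtain ⟨c, hc⟩ := h t₁ (b t₁) hR
    exact ⟨by linarith, _, hb.append hF.cont (le_of_lt ht₁) (by linarith) hc⟩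
  have hle : ∀ T ∈ 𝒯, (T : EReal) ≤ Tmax := fun T hT => le_sSup ⟨T, hT, rfl⟩
  have hlt : ∀ t : ℝ, (t : EReal) < Tmax → ∃ T ∈ 𝒯, t < T := by
    intro t ht
    obtain ⟨_, ⟨T, hT, rfl⟩, h⟩ := lt_sSup_iff.mp ht
    exact ⟨T, hT, EReal.coe_lt_coe_iff.mp h⟩
  -- The supremum is not attained: any solution on a compact interval can be prolonged.
  have hmem_lt : ∀ T ∈ 𝒯, (T : EReal) < Tmax := by
    rintro T ⟨hT, b, hb⟩
    obtain ⟨τ, hτ, h⟩ := hextend ‖b T‖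
    refine lt_of_lt_of_le ?_ (hle _ (h T hT b hb le_rfl))
    exact_mod_cast (by linarith : T < T + τ)
  have hne : ∃ T ∈ 𝒯, t₀ < T := by
    obtain ⟨τ, hτ, h⟩ := hF.exists_solution ‖x₀‖
    obtain ⟨c, hc⟩ := h t₀ x₀ le_rfl
    exact ⟨t₀ + τ, ⟨by linarith, c, hc⟩, by linarith⟩
  choose! B hB using fun T (hT : T ∈ 𝒯) => hT.2
  -- The interval used at each `t` is an arbitrary choice; uniqueness makes it immaterial.
  set u : ℝ → X := fun t => if h : ∃ T ∈ 𝒯, t < T then B h.choose t else 0 with hu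
  have hagree : ∀ T v, IsIntegralSolution F t₀ x₀ (Icc t₀ T) v → ∀ t, t₀ ≤ t → t ≤ T →
      (∃ T ∈ 𝒯, t < T) → u t = v t := by
    intro T v hv t ht htT hex
    have h1 : u t = B hex.choose t := by simp only [hu, dif_pos hex]
    rw [h1]
    have h2 := hex.choose_spec
    exact ((hB _ h2.1).mono (Icc_subset_Icc_right h2.2.le)).eqOn hF
      (hv.mono (Icc_subset_Icc_right htT)) ⟨ht, le_rfl⟩
  have husol : ∀ T v, IsIntegralSolution F t₀ x₀ (Icc t₀ T) v → t₀ < T →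
      EqOn u v (Icc t₀ T) := by
    intro T v hv hT t ht
    refine hagree T v hv t ht.1 ht.2 (hlt t (lt_of_le_of_lt ?_ (hmem_lt T ⟨hT, v, hv⟩)))
    exact_mod_cast ht.2
  refine ⟨Tmax, u, ⟨?_, ?_, ?_⟩, fun T v hT hv =>
    ⟨hmem_lt T ⟨hT, v, hv⟩, (husol T v hv hT).symm⟩⟩
  · obtain ⟨T, hT, h⟩ := hne
    exact lt_of_lt_of_le (by exact_mod_cast h) (hle T hT)
  · refine IsIntegralSolution.of_forall_Icc (fun t ht => ht.1) fun t ht => ?_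
    obtain ⟨T, hT, h⟩ := hlt t ht.2
    exact ⟨T, h, (hB T hT).congr_Icc (husol T _ (hB T hT) hT.1)⟩
  · intro T hT
    by_contra hcon
    -- Without divergence there are times arbitrarily close to `T` with norm at most one fixed `R`.
    -- Restarting within `τ` of `T` then passes `T`.
    obtain ⟨R, hR⟩ : ∃ R : ℝ, ∃ᶠ t in 𝓝[<] T, ‖u t‖ ≤ R := by
      rw [Filter.tendsto_atTop] at hcon
      push Not at hcon
      obtain ⟨R, hR⟩ := hcon
      exact ⟨R, hR.mono fun t ht => le_of_lt ht⟩
    obtain ⟨τ, hτ, h⟩ := hextend R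
    have ht₀ : t₀ < T := by
      obtain ⟨T', hT', h'⟩ := hne
      have := hmem_lt T' hT'
      rw [hT] at this
      exact h'.trans (by exact_mod_cast this)
    obtain ⟨t, htR, ht⟩ := (hR.and_eventually (Ioo_mem_nhdsLT
      (max_lt ht₀ (by linarith : T - τ < T)))).exists
    have ht1 : t₀ < t := (le_max_left _ _).trans_lt ht.1
    have ht2 : T - τ < t := (le_max_right _ _).trans_lt ht.1
    obtain ⟨T', hT', htT'⟩ := hlt t (by rw [hT]; exact_mod_cast ht.2)
    have hsol : IsIntegralSolution F t₀ x₀ (Icc t₀ t) u :=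
      ((hB T' hT').congr_Icc (husol T' _ (hB T' hT') hT'.1)).mono (Icc_subset_Icc_right htT'.le)
    have := hmem_lt _ (h t ht1 u hsol htR)
    rw [hT] at this
    have : t + τ < T := by exact_mod_cast this
    linarith

/-- A solution of a nearby equation bounds the existence time of a maximal solution from below,
and stays close to it. -/
theorem IsMaximalIntegralSolution.dist_lt [CompleteSpace X] {F G : ℝ → X → X} {t₀ T : ℝ} {x₀ : X}
    {Tmax : EReal} {b c : ℝ → X} (hF : Continuous fun p : ℝ × X => F p.1 p.2)
    (hG : Continuous fun p : ℝ × X => G p.1 p.2) (hb : IsMaximalIntegralSolution F t₀ x₀ Tmax b)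
    (hT : t₀ ≤ T) (hc : IsIntegralSolution G t₀ x₀ (Icc t₀ T) c) {R δ η : ℝ} {K : ℝ≥0}
    (hR : ∀ t ∈ Icc t₀ T, ‖c t‖ ≤ R) (hK : ∀ t, LipschitzOnWith K (F t) (closedBall 0 (R + 1)))
    (hδ : ∀ t ∈ Icc t₀ T, ‖F t (c t) - G t (c t)‖ ≤ δ) (hη : η ≤ 1)
    (hδη : gronwallBound 0 K δ (T - t₀) < η) :
    (T : EReal) < Tmax ∧ ∀ t ∈ Icc t₀ T, ‖b t - c t‖ < η := by
  have hδ0 : 0 ≤ δ := (norm_nonneg _).trans (hδ t₀ (left_mem_Icc.mpr hT))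
  have key : ∀ T' ≤ T, (T' : EReal) < Tmax → ∀ t ∈ Icc t₀ T', ‖b t - c t‖ < η := by
    intro T' hT' hT'max
    by_contra! hcon
    -- Continuity argument: before the first time at which the distance reaches `η ≤ 1`, both
    -- trajectories lie in the ball of radius `R + 1`, so Gronwall applies and keeps the distance
    -- below `η` at that time as well.
    set S : Set ℝ := {t ∈ Icc t₀ T' | η ≤ ‖b t - c t‖} with hS
    have hbT' : IsIntegralSolution F t₀ x₀ (Icc t₀ T') b :=
      hb.isSolution.mono fun t ht => ⟨ht.1, lt_of_le_of_lt (by exact_mod_cast ht.2) hT'max⟩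
    have hcT' := hc.mono (Icc_subset_Icc_right hT')
    have hSc : IsClosed S := by
      have : S = Icc t₀ T' ∩ (fun t => ‖b t - c t‖) ⁻¹' Ici η := rfl
      rw [this]
      exact (hbT'.cont.sub hcT'.cont).norm.preimage_isClosed_of_isClosed isClosed_Icc isClosed_Ici
    have hSb : BddBelow S := ⟨t₀, fun t ht => ht.1.1⟩
    have hmem : sInf S ∈ S := hSc.csInf_mem hcon hSb
    set r := sInf S with hr
    have hrI : Icc t₀ r ⊆ Icc t₀ T' := Icc_subset_Icc_right hmem.1.2
    have hbr := hbT'.mono hrI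
    have hcr := hcT'.mono hrI
    have hsmall : ∀ t ∈ Ico t₀ r, ‖b t - c t‖ < η := by
      intro t ht
      by_contra! h
      exact absurd (csInf_le hSb (⟨hrI (Ico_subset_Icc_self ht), h⟩ : t ∈ S)) (not_le.mpr ht.2)
    have hIT : ∀ t ∈ Ico t₀ r, t ∈ Icc t₀ T := fun t ht =>
      ⟨ht.1, ht.2.le.trans (hmem.1.2.trans hT')⟩
    -- Here `b` solves the equation of `F` exactly, and `c` solves it up to the error `δ`.
    have hgr := dist_le_of_approx_trajectories_ODE_of_mem (v := F) (K := K) (δ := 0)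
      (s := fun _ => closedBall 0 (R + 1)) (εf := 0) (εg := δ) (fun t _ => hK t) hbr.cont
      (fun t ht => hbr.hasDerivWithinAt hF ht) (fun t _ => by simp) (fun t ht => ?_) hcr.cont
      (fun t ht => hcr.hasDerivWithinAt hG ht) (fun t ht => ?_) (fun t ht => ?_) ?_ r
      (right_mem_Icc.mpr hmem.1.1)
    · rw [dist_eq_norm, zero_add] at hgr
      have : gronwallBound 0 K δ (r - t₀) ≤ gronwallBound 0 K δ (T - t₀) :=
        gronwallBound_mono le_rfl hδ0 K.2 (by linarith [hmem.1.2])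
      linarith [hmem.2]
    · have h1 := hsmall t ht
      have h2 := hR t (hIT t ht)
      have h3 := norm_sub_norm_le (b t) (c t)
      rw [mem_closedBall_zero_iff]
      linarith
    · rw [dist_comm, dist_eq_norm]; exact hδ t (hIT t ht)
    · rw [mem_closedBall_zero_iff]
      linarith [hR t (hIT t ht)]
    · rw [hbr.apply_left (left_mem_Icc.mpr hmem.1.1), hcr.apply_left (left_mem_Icc.mpr hmem.1.1)]
      simp
  -- Otherwise `b` blows up by time `T`, while `key` keeps it within `η ≤ 1` of the bounded `c`.
  have hTmax : (T : EReal) < Tmax := by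
    by_contra! h
    obtain ⟨T', rfl⟩ : ∃ T' : ℝ, Tmax = T' :=
      ⟨Tmax.toReal, (EReal.coe_toReal (fun h' => by simp [h'] at h)
        (fun h' => by simpa [h'] using hb.lt)).symm⟩
    have hT'T : T' ≤ T := by exact_mod_cast h
    have ht₀ : t₀ < T' := by exact_mod_cast hb.lt
    obtain ⟨t, htR, ht⟩ := (((hb.blowup T' rfl).eventually_gt_atTop (R + 1)).and
      (Ioo_mem_nhdsLT ht₀)).exists
    have h1 := key t (ht.2.le.trans hT'T) (by exact_mod_cast ht.2) t ⟨ht.1.le, le_rfl⟩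
    have h2 := hR t ⟨ht.1.le, ht.2.le.trans hT'T⟩
    have h3 := norm_sub_norm_le (b t) (c t)
    linarith
  exact ⟨hTmax, key T le_rfl hTmax⟩

end IntegralSolutions

/-! ### H^s as an isometric copy of L², and the Schrödinger group on it. -/

section SobolevModel

variable {d : ℕ}

theorem eLpNorm_two_sq {β : Type*} [MeasurableSpace β] {μ : Measure β} (f : β → ℂ) :
    eLpNorm f 2 μ ^ 2 = ∫⁻ x, ‖f x‖ₑ ^ 2 ∂μ := by
  rw [eLpNorm_eq_lintegral_rpow_enorm_toReal two_ne_zero ENNReal.ofNat_ne_top,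
    ← ENNReal.rpow_two, ← ENNReal.rpow_mul]
  simp

/-- Multiplication by a bounded function, as an operator on `L²`. -/
noncomputable def mulOp (m : EuclideanSpace ℝ (Fin d) → ℂ) (hm : MemLp m ∞ volume) :
    L2 d →L[ℂ] L2 d :=
  (ContinuousLinearMap.mul ℂ ℂ).holderL volume ∞ 2 2 (hm.toLp m)

theorem mulOp_ae {m : EuclideanSpace ℝ (Fin d) → ℂ} (hm : MemLp m ∞ volume) (f : L2 d) :
    mulOp m hm f =ᵐ[volume] fun ξ => m ξ * f ξ := by
  filter_upwards [(ContinuousLinearMap.mul ℂ ℂ).coeFn_holder (r := 2) (hm.toLp m) f,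
    hm.coeFn_toLp] with ξ h1 h2
  rw [mulOp, ContinuousLinearMap.holderL_apply_apply, h1, h2]
  rfl

theorem lpSMul_eq_mulOp {m : EuclideanSpace ℝ (Fin d) → ℂ} (hm : MemLp m ∞ volume) (f : L2 d) :
    ((hm.toLp m) • f : L2 d) = mulOp m hm f := by
  refine Lp.ext ?_
  filter_upwards [Lp.coeFn_lpSMul (r := 2) (hm.toLp m) f, hm.coeFn_toLp, mulOp_ae hm f]
    with ξ h1 h2 h3
  rw [h1, h3, Pi.smul_apply', h2, smul_eq_mul]

/-- The weight `(1 + 4π²|ξ|²)^{s/2}`, the symbol of `(1 - Δ)^{s/2}`. -/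
noncomputable def sobolevWeight (s : ℝ) (ξ : EuclideanSpace ℝ (Fin d)) : ℝ :=
  (1 + 4 * Real.pi ^ 2 * ‖ξ‖ ^ 2) ^ (s / 2)

theorem sobolevWeight_pos (s : ℝ) (ξ : EuclideanSpace ℝ (Fin d)) : 0 < sobolevWeight s ξ := by
  unfold sobolevWeight; positivity

theorem one_le_sobolevWeight {s : ℝ} (hs : 0 ≤ s) (ξ : EuclideanSpace ℝ (Fin d)) :
    1 ≤ sobolevWeight s ξ :=
  Real.one_le_rpow (by nlinarith [sq_nonneg (Real.pi * ‖ξ‖)]) (by positivity)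

theorem continuous_sobolevWeight (s : ℝ) :
    Continuous (sobolevWeight s : EuclideanSpace ℝ (Fin d) → ℝ) := by
  unfold sobolevWeight
  refine Continuous.rpow_const (by fun_prop) fun ξ => Or.inl (by positivity)

theorem memLp_inv_sobolevWeight {s : ℝ} (hs : 0 ≤ s) :
    MemLp (fun ξ : EuclideanSpace ℝ (Fin d) => (((sobolevWeight s ξ)⁻¹ : ℝ) : ℂ)) ∞ volume := by
  refine memLp_top_of_bound (Continuous.aestronglyMeasurable ?_) 1
    (Eventually.of_forall fun ξ => ?_)
  · exact Complex.continuous_ofReal.comp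
      ((continuous_sobolevWeight s).inv₀ fun ξ => (sobolevWeight_pos s ξ).ne')
  · rw [Complex.norm_real, norm_inv, Real.norm_of_nonneg (sobolevWeight_pos s ξ).le]
    exact inv_le_one_of_one_le₀ (one_le_sobolevWeight hs ξ)

/-- The isometry of `L²` onto `H^s` which on the Fourier side divides by the weight
`(1 + 4π²|ξ|²)^{s/2}`. -/
noncomputable def sobolevEmb {s : ℝ} (hs : 0 ≤ s) : L2 d →L[ℂ] L2 d :=
  (Lp.fourierTransformₗᵢ (EuclideanSpace ℝ (Fin d)) ℂ).symm.toContinuousLinearEquiv.toContinuousLinearMap ∘L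
    mulOp _ (memLp_inv_sobolevWeight hs)

theorem fourier_sobolevEmb {s : ℝ} (hs : 0 ≤ s) (a : L2 d) :
    (𝓕 (sobolevEmb hs a) : L2 d) = mulOp _ (memLp_inv_sobolevWeight hs) a :=
  (Lp.fourierTransformₗᵢ (EuclideanSpace ℝ (Fin d)) ℂ).apply_symm_apply _

theorem sobolevEmb_eq {s : ℝ} (hs : 0 ≤ s) (a : L2 d) :
    sobolevEmb hs a = (𝓕⁻ (mulOp _ (memLp_inv_sobolevWeight hs) a : L2 d) : L2 d) := rfl

theorem fourier_sobolevEmb_ae {s : ℝ} (hs : 0 ≤ s) (a : L2 d) :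
    (𝓕 (sobolevEmb hs a) : L2 d) =ᵐ[volume] fun ξ => ((sobolevWeight s ξ : ℂ))⁻¹ * a ξ := by
  rw [fourier_sobolevEmb]
  filter_upwards [mulOp_ae (memLp_inv_sobolevWeight hs) a] with ξ h
  rw [h, Complex.ofReal_inv]

/-- The weight in the norm cancels the division by the weight; every H^s estimate thereby becomes an
L² estimate. -/
theorem hsNorm_sobolevEmb {s : ℝ} (hs : 0 ≤ s) (a : L2 d) :
    hsNorm s (sobolevEmb hs a) = ‖a‖ₑ := by
  rw [Lp.enorm_def, hsNorm]
  refine eLpNorm_congr_ae ?_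
  filter_upwards [fourier_sobolevEmb_ae hs a] with ξ h
  rw [h]
  have : (sobolevWeight s ξ : ℂ) ≠ 0 := by exact_mod_cast (sobolevWeight_pos s ξ).ne'
  exact mul_inv_cancel_left₀ this _

theorem sobolevEmb_injective {s : ℝ} (hs : 0 ≤ s) :
    Function.Injective (sobolevEmb hs : L2 d → L2 d) := by
  refine (injective_iff_map_eq_zero _).mpr fun a ha => ?_
  have h := hsNorm_sobolevEmb hs a
  rw [ha, ← map_zero (sobolevEmb hs : L2 d →L[ℂ] L2 d), hsNorm_sobolevEmb] at h
  simpa using h.symm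

theorem toTemperedDistribution_injective {p : ℝ≥0∞} [Fact (1 ≤ p)]
    {f g : Lp ℂ p (volume : Measure (EuclideanSpace ℝ (Fin d)))}
    (h : (f : 𝓢'(EuclideanSpace ℝ (Fin d), ℂ)) = g) : f = g :=
  LinearMap.ker_eq_bot.mp (Lp.ker_toTemperedDistributionCLM_eq_bot (F := ℂ) (p := p)
    (μ := (volume : Measure (EuclideanSpace ℝ (Fin d))))) h

theorem sobolevWeight_le (s : ℝ) (hs : 0 ≤ s) (ξ : EuclideanSpace ℝ (Fin d)) :
    sobolevWeight s ξ ≤ (4 * Real.pi ^ 2) ^ (s / 2) * (1 + ‖ξ‖ ^ 2) ^ (s / 2) := by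
  rw [← Real.mul_rpow (by positivity) (by positivity)]
  refine Real.rpow_le_rpow (by positivity) ?_ (by positivity)
  nlinarith [Real.pi_gt_three, sq_nonneg ‖ξ‖]

theorem le_sobolevWeight (s : ℝ) (hs : 0 ≤ s) (ξ : EuclideanSpace ℝ (Fin d)) :
    (1 + ‖ξ‖ ^ 2) ^ (s / 2) ≤ sobolevWeight s ξ := by
  refine Real.rpow_le_rpow (by positivity) ?_ (by positivity)
  have : 1 ≤ 4 * Real.pi ^ 2 := by nlinarith [Real.pi_gt_three]
  nlinarith [sq_nonneg ‖ξ‖]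

/-- `MemSobolev` uses the weight (1 + |ξ|²)^{s/2}, without 4π². Its quotient by `sobolevWeight` is
bounded, hence an L² multiplier. -/
theorem memHs_sobolevEmb {s : ℝ} (hs : 0 ≤ s) (a : L2 d) : MemHs s (sobolevEmb hs a) := by
  rw [MemHs, TemperedDistribution.memSobolev_iff_exists_smulLeftCLM_fourier,
    Lp.fourier_toTemperedDistribution_eq]
  have hm : MemLp (fun ξ : EuclideanSpace ℝ (Fin d) =>
      ((((1 + ‖ξ‖ ^ 2) ^ (s / 2) * (sobolevWeight s ξ)⁻¹ : ℝ)) : ℂ)) ∞ volume := by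
    refine memLp_top_of_bound (Continuous.aestronglyMeasurable ?_) 1
      (Eventually.of_forall fun ξ => ?_)
    · refine Complex.continuous_ofReal.comp (Continuous.mul ?_
        ((continuous_sobolevWeight s).inv₀ fun ξ => (sobolevWeight_pos s ξ).ne'))
      exact Continuous.rpow_const (by fun_prop) fun ξ => Or.inl (by positivity)
    · have := sobolevWeight_pos s ξ
      rw [Complex.norm_real, Real.norm_of_nonneg (by positivity), mul_inv_le_iff₀ this, one_mul]
      exact le_sobolevWeight s hs ξ
  refine ⟨mulOp _ hm a, ?_⟩
  ext u
  rw [TemperedDistribution.smulLeftCLM_apply_apply, Lp.toTemperedDistribution_apply,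
    Lp.toTemperedDistribution_apply]
  refine integral_congr_ae ?_
  filter_upwards [mulOp_ae hm a, fourier_sobolevEmb_ae hs a] with ξ h1 h2
  rw [h1, h2, SchwartzMap.smulLeftCLM_apply_apply (by fun_prop)]
  simp only [smul_eq_mul]
  push_cast
  ring

theorem exists_sobolevEmb_eq {s : ℝ} (hs : 0 ≤ s) {f : L2 d} (hf : MemHs s f) :
    ∃ a, sobolevEmb hs a = f := by
  rw [MemHs, TemperedDistribution.memSobolev_iff_exists_smulLeftCLM_fourier,
    Lp.fourier_toTemperedDistribution_eq] at hf
  obtain ⟨g, hg⟩ := hf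
  have hm₁ : MemLp (fun ξ : EuclideanSpace ℝ (Fin d) =>
      (((1 + ‖ξ‖ ^ 2) ^ (-s / 2) : ℝ) : ℂ)) ∞ volume := by
    refine memLp_top_of_bound (Continuous.aestronglyMeasurable ?_) 1
      (Eventually.of_forall fun ξ => ?_)
    · refine Complex.continuous_ofReal.comp ?_
      exact Continuous.rpow_const (by fun_prop) fun ξ => Or.inl (by positivity)
    · rw [Complex.norm_real, Real.norm_of_nonneg (by positivity)]
      exact Real.rpow_le_one_of_one_le_of_nonpos (by simp) (by linarith)
  -- The hypothesis on `g` is an identity of tempered distributions, so the weight is inverted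
  -- there, and injectivity of L² into distributions brings the result back.
  have hfg : (𝓕 f : L2 d) = mulOp _ hm₁ g := by
    rw [← lpSMul_eq_mulOp]
    refine toTemperedDistribution_injective ?_
    rw [Lp.toTemperedDistribution_smul_eq (by fun_prop), ← hg,
      TemperedDistribution.smulLeftCLM_smulLeftCLM_apply (by fun_prop) (by fun_prop)]
    have h1 : ((fun ξ : EuclideanSpace ℝ (Fin d) => (((1 + ‖ξ‖ ^ 2) ^ (s / 2) : ℝ) : ℂ)) *
        fun ξ => (((1 + ‖ξ‖ ^ 2) ^ (-s / 2) : ℝ) : ℂ)) = fun _ => 1 := by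
      ext ξ
      rw [Pi.mul_apply, ← Complex.ofReal_mul, ← Real.rpow_add (by positivity)]
      ring_nf
      simp
    rw [h1, TemperedDistribution.smulLeftCLM_const, one_smul]
  have hm₂ : MemLp (fun ξ : EuclideanSpace ℝ (Fin d) =>
      ((sobolevWeight s ξ * (1 + ‖ξ‖ ^ 2) ^ (-s / 2) : ℝ) : ℂ)) ∞ volume := by
    refine memLp_top_of_bound (Continuous.aestronglyMeasurable ?_) ((4 * Real.pi ^ 2) ^ (s / 2))
      (Eventually.of_forall fun ξ => ?_)
    · refine Complex.continuous_ofReal.comp (Continuous.mul (continuous_sobolevWeight s) ?_)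
      exact Continuous.rpow_const (by fun_prop) fun ξ => Or.inl (by positivity)
    · have := sobolevWeight_pos s ξ
      rw [Complex.norm_real, Real.norm_of_nonneg (by positivity), neg_div,
        Real.rpow_neg (by positivity), mul_inv_le_iff₀ (by positivity)]
      exact sobolevWeight_le s hs ξ
  -- This is `sobolevWeight` times 𝓕 f, expressed through `g` so that membership in L² is evident.
  refine ⟨mulOp _ hm₂ g, ?_⟩
  refine (Lp.fourierTransformₗᵢ (EuclideanSpace ℝ (Fin d)) ℂ).injective ?_
  change (𝓕 (sobolevEmb hs _) : L2 d) = (𝓕 f : L2 d)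
  rw [hfg]
  refine Lp.ext ?_
  filter_upwards [fourier_sobolevEmb_ae hs (mulOp _ hm₂ g), mulOp_ae hm₂ g, mulOp_ae hm₁ g]
    with ξ h1 h2 h3
  rw [h1, h2, h3]
  have : (sobolevWeight s ξ : ℂ) ≠ 0 := by exact_mod_cast (sobolevWeight_pos s ξ).ne'
  push_cast
  field_simp

/-- The symbol of `e^{iθΔ}`. -/
noncomputable def schrodingerSymbol (θ : ℝ) (ξ : EuclideanSpace ℝ (Fin d)) : ℂ :=
  Complex.exp (-(Complex.I * ((θ * (4 * Real.pi ^ 2 * ‖ξ‖ ^ 2) : ℝ) : ℂ)))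

theorem norm_schrodingerSymbol (θ : ℝ) (ξ : EuclideanSpace ℝ (Fin d)) :
    ‖schrodingerSymbol θ ξ‖ = 1 := by
  simp only [schrodingerSymbol, Complex.norm_exp, Complex.neg_re, Complex.I_mul_re,
    Complex.ofReal_im, neg_zero, Real.exp_zero]

/-- The action of `e^{iθΔ}` on the Fourier side. -/
noncomputable def schrodingerMul (θ : ℝ) : L2 d →L[ℂ] L2 d :=
  mulOp (schrodingerSymbol θ) (memLp_schrodingerSymbol d θ)

theorem schrodingerMul_ae (θ : ℝ) (a : L2 d) :
    schrodingerMul θ a =ᵐ[volume] fun ξ => schrodingerSymbol θ ξ * a ξ :=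
  mulOp_ae _ a

theorem norm_schrodingerMul (θ : ℝ) (a : L2 d) : ‖schrodingerMul θ a‖ = ‖a‖ := by
  rw [Lp.norm_def, Lp.norm_def]
  congr 1
  refine eLpNorm_congr_norm_ae ?_
  filter_upwards [schrodingerMul_ae θ a] with ξ h
  rw [h, norm_mul, norm_schrodingerSymbol, one_mul]

theorem schrodingerMul_add (θ θ' : ℝ) (a : L2 d) :
    schrodingerMul (θ + θ') a = schrodingerMul θ (schrodingerMul θ' a) := by
  refine Lp.ext ?_
  filter_upwards [schrodingerMul_ae (θ + θ') a, schrodingerMul_ae θ' a,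
    schrodingerMul_ae θ (schrodingerMul θ' a)] with ξ h1 h2 h3
  rw [h1, h3, h2, ← mul_assoc, schrodingerSymbol, schrodingerSymbol, schrodingerSymbol,
    ← Complex.exp_add]
  congr 2
  push_cast
  ring

theorem schrodingerMul_zero (a : L2 d) : schrodingerMul 0 a = a := by
  refine Lp.ext ?_
  filter_upwards [schrodingerMul_ae 0 a] with ξ h1
  rw [h1, schrodingerSymbol]
  simp

theorem schrodingerOp_sobolevEmb {s : ℝ} (hs : 0 ≤ s) (θ : ℝ) (a : L2 d) :
    schrodingerOp θ (sobolevEmb hs a) = sobolevEmb hs (schrodingerMul θ a) := by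
  rw [schrodingerOp, lpSMul_eq_mulOp, sobolevEmb_eq hs (schrodingerMul θ a)]
  congr 1
  refine Lp.ext ?_
  filter_upwards [mulOp_ae (memLp_schrodingerSymbol d θ) (𝓕 (sobolevEmb hs a) : L2 d),
    fourier_sobolevEmb_ae hs a, mulOp_ae (memLp_inv_sobolevWeight hs) (schrodingerMul θ a),
    schrodingerMul_ae θ a] with ξ h1 h2 h3 h4
  rw [h1, h2, h3, h4, schrodingerSymbol]
  push_cast
  ring

/-- Dominated convergence with majorant (2|a|)². The symbols converge pointwise but not uniformly in
ξ, so only strong continuity results. -/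
theorem continuous_schrodingerMul_apply (a : L2 d) :
    Continuous fun θ : ℝ => schrodingerMul θ a := by
  refine continuous_iff_continuousAt.mpr fun θ => ?_
  rw [ContinuousAt, tendsto_iff_edist_tendsto_0]
  have hsq : Tendsto (fun θ' => edist (schrodingerMul θ' a) (schrodingerMul θ a) ^ 2) (𝓝 θ)
      (𝓝 0) := by
    have heq : ∀ θ', edist (schrodingerMul θ' a) (schrodingerMul θ a) ^ 2 =
        ∫⁻ ξ, (‖schrodingerSymbol θ' ξ - schrodingerSymbol θ ξ‖ₑ * ‖a ξ‖ₑ) ^ 2 := by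
      intro θ'
      rw [edist_eq_enorm_sub, Lp.enorm_def, eLpNorm_two_sq]
      refine lintegral_congr_ae ?_
      filter_upwards [Lp.coeFn_sub (schrodingerMul θ' a) (schrodingerMul θ a),
        schrodingerMul_ae θ' a, schrodingerMul_ae θ a] with ξ h1 h2 h3
      rw [h1, Pi.sub_apply, h2, h3, ← sub_mul, enorm_mul]
    have hc : ∀ θ' : ℝ, Continuous (schrodingerSymbol θ' : EuclideanSpace ℝ (Fin d) → ℂ) := by
      intro θ'; unfold schrodingerSymbol; fun_prop
    have hbound : ∫⁻ ξ, (2 * ‖a ξ‖ₑ) ^ 2 ≠ ∞ := by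
      simp_rw [mul_pow]
      rw [lintegral_const_mul' _ _ (by simp), ← eLpNorm_two_sq]
      exact ENNReal.mul_ne_top (by simp) (ENNReal.pow_ne_top (Lp.eLpNorm_ne_top a))
    have h0 : ∫⁻ ξ, (‖schrodingerSymbol θ ξ - schrodingerSymbol θ ξ‖ₑ * ‖a ξ‖ₑ) ^ 2 = 0 := by
      simp
    simp_rw [heq]
    rw [← h0]
    refine tendsto_lintegral_filter_of_dominated_convergence _
      (Eventually.of_forall fun θ' => ?_) (Eventually.of_forall fun θ' => ?_) hbound
      (Eventually.of_forall fun ξ => ?_)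
    · exact (((hc θ').sub (hc θ)).measurable.enorm.mul
        (Lp.stronglyMeasurable a).measurable.enorm).pow_const 2
    · refine Eventually.of_forall fun ξ => ?_
      gcongr
      refine (enorm_sub_le).trans ?_
      rw [← ofReal_norm, ← ofReal_norm, norm_schrodingerSymbol, norm_schrodingerSymbol]
      norm_num
    · have : Continuous fun θ' => ‖schrodingerSymbol θ' ξ - schrodingerSymbol θ ξ‖ₑ := by
        unfold schrodingerSymbol
        fun_prop
      exact ((ENNReal.continuous_pow 2).tendsto _).comp
        (ENNReal.Tendsto.mul_const (this.tendsto θ) (Or.inr (by simp)))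
  have := (ENNReal.continuous_rpow_const (y := 1 / 2)).tendsto 0 |>.comp hsq
  simp only [Function.comp_def, ← ENNReal.rpow_two, ← ENNReal.rpow_mul] at this
  norm_num at this
  exact this

theorem continuous_schrodingerMul : Continuous fun p : ℝ × L2 d => schrodingerMul p.1 p.2 := by
  refine continuous_prod_of_continuous_lipschitzWith' _ 1 (fun θ => ?_)
    continuous_schrodingerMul_apply
  refine LipschitzWith.of_dist_le_mul fun a b => ?_
  rw [dist_eq_norm, ← map_sub, norm_schrodingerMul, dist_eq_norm]
  simp

end SobolevModel

/-! ### Continuous representatives and the algebra property for s > d/2. -/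

section SobolevProduct

open scoped Convolution

variable {d : ℕ}

/-- The inverse Fourier transforms on `L²` and on `L¹` agree. -/
theorem fourierInv_ae_eq {f : EuclideanSpace ℝ (Fin d) → ℂ} (hf : Integrable f) {F : L2 d}
    (hF : F =ᵐ[volume] f) : (𝓕⁻ F : L2 d) =ᵐ[volume] 𝓕⁻ f := by
  have hf' : Integrable fun x => f (-x) := hf.comp_neg
  have hcont : Continuous (𝓕⁻ f) := by
    rw [Real.fourierInv_eq_fourier_comp_neg]
    exact VectorFourier.fourierIntegral_continuous Real.continuous_fourierChar
      (by exact continuous_inner) hf'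
  -- Both sides are compared against test functions: duality of tempered distributions on the L²
  -- side, Fubini on the L¹ side.
  refine ae_eq_of_integral_contDiff_smul_eq
    ((Lp.memLp (𝓕⁻ F : L2 d)).locallyIntegrable one_le_two) hcont.locallyIntegrable
    fun g hg hgc => ?_
  have hg₁ : HasCompactSupport (Complex.ofRealCLM ∘ g) := hgc.comp_left rfl
  have hg₂ : ContDiff ℝ ((⊤ : ℕ∞) : WithTop ℕ∞) (Complex.ofRealCLM ∘ g) :=
    Complex.ofRealCLM.contDiff.comp hg
  set φ : 𝓢(EuclideanSpace ℝ (Fin d), ℂ) := hg₁.toSchwartzMap hg₂ with hφ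
  have hφg : ∀ x, φ x = (g x : ℂ) := fun x => rfl
  have h1 : ∫ x, g x • (𝓕⁻ F : L2 d) x = ∫ ξ, 𝓕⁻ φ ξ • f ξ := by
    calc ∫ x, g x • (𝓕⁻ F : L2 d) x
        = ((𝓕⁻ F : L2 d) : 𝓢'(EuclideanSpace ℝ (Fin d), ℂ)) φ := by
          rw [Lp.toTemperedDistribution_apply]
          simp [hφg]
      _ = (F : 𝓢'(EuclideanSpace ℝ (Fin d), ℂ)) (𝓕⁻ φ) := by
          rw [← Lp.fourierInv_toTemperedDistribution_eq, TemperedDistribution.fourierInv_apply]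
      _ = ∫ ξ, 𝓕⁻ φ ξ • f ξ := by
          rw [Lp.toTemperedDistribution_apply]
          exact integral_congr_ae (hF.mono fun ξ h => by simp only [h])
  rw [h1]
  have h2 : ∫ ξ, 𝓕 (φ : EuclideanSpace ℝ (Fin d) → ℂ) ξ • f (-ξ) =
      ∫ x, φ x • 𝓕 (fun y => f (-y)) x := by
    simpa using! VectorFourier.integral_fourierIntegral_smul_eq_flip (L := innerₗ _)
      Real.continuous_fourierChar continuous_inner φ.integrable hf'
  rw [Real.fourierInv_eq_fourier_comp_neg f]
  have h3 : ∫ x, g x • 𝓕 (fun y => f (-y)) x = ∫ x, φ x • 𝓕 (fun y => f (-y)) x := by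
    simp [hφg]
  rw [h3, ← h2, ← integral_neg_eq_self]
  refine integral_congr_ae (Eventually.of_forall fun ξ => ?_)
  simp only [SchwartzMap.fourierInv_coe, Real.fourierInv_eq_fourier_neg, neg_neg]

/-- This is where s > d/2 enters: it makes the inverse weight square integrable. -/
theorem lintegral_inv_sobolevWeight_sq_lt_top {s : ℝ} (hds : (d : ℝ) < 2 * s) :
    ∫⁻ ξ : EuclideanSpace ℝ (Fin d), ENNReal.ofReal ((sobolevWeight s ξ)⁻¹ ^ 2) < ∞ := by
  have hs : 0 ≤ s := by
    have : (0 : ℝ) ≤ d := by positivity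
    linarith
  have hint := integrable_rpow_neg_one_add_norm_sq (E := EuclideanSpace ℝ (Fin d))
    (μ := volume) (r := 2 * s) (by simpa using hds)
  refine lt_of_le_of_lt (lintegral_mono fun ξ => ENNReal.ofReal_le_ofReal ?_)
    hint.lintegral_lt_top
  have h1 := le_sobolevWeight s hs ξ
  have h2 : (1 + ‖ξ‖ ^ 2) ^ (-(2 * s) / 2) = (((1 + ‖ξ‖ ^ 2) ^ (s / 2))⁻¹) ^ 2 := by
    rw [← Real.rpow_neg (by positivity), ← Real.rpow_mul_natCast (by positivity)]
    congr 1; push_cast; ring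
  rw [h2]
  have := sobolevWeight_pos s ξ
  gcongr

theorem memLp_inv_sobolevWeight_two {s : ℝ} (hds : (d : ℝ) < 2 * s) :
    MemLp (fun ξ : EuclideanSpace ℝ (Fin d) => (((sobolevWeight s ξ)⁻¹ : ℝ) : ℂ)) 2 volume := by
  refine ⟨Continuous.aestronglyMeasurable ?_, ?_⟩
  · exact Complex.continuous_ofReal.comp
      ((continuous_sobolevWeight s).inv₀ fun ξ => (sobolevWeight_pos s ξ).ne')
  · refine (ENNReal.pow_lt_top_iff.mp ?_).resolve_right two_ne_zero
    rw [eLpNorm_two_sq]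
    refine lt_of_eq_of_lt (lintegral_congr fun ξ => ?_)
      (lintegral_inv_sobolevWeight_sq_lt_top hds)
    rw [← ofReal_norm, Complex.norm_real, Real.norm_of_nonneg
      (inv_nonneg.mpr (sobolevWeight_pos s ξ).le), ENNReal.ofReal_pow
      (inv_nonneg.mpr (sobolevWeight_pos s ξ).le)]

theorem integrable_inv_sobolevWeight_mul {s : ℝ} (hds : (d : ℝ) < 2 * s) (a : L2 d) :
    Integrable fun ξ => (((sobolevWeight s ξ)⁻¹ : ℝ) : ℂ) * a ξ :=
  (memLp_inv_sobolevWeight_two hds).integrable_mul (Lp.memLp a)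

/-- The continuous representative of the `H^s` function `sobolevEmb a`, when `s > d/2`. -/
noncomputable def sobolevRep (s : ℝ) (a : L2 d) : EuclideanSpace ℝ (Fin d) → ℂ :=
  𝓕⁻ fun ξ => (((sobolevWeight s ξ)⁻¹ : ℝ) : ℂ) * a ξ

theorem sobolevEmb_ae {s : ℝ} (hs : 0 ≤ s) (hds : (d : ℝ) < 2 * s) (a : L2 d) :
    sobolevEmb hs a =ᵐ[volume] sobolevRep s a := by
  rw [sobolevEmb_eq]
  exact fourierInv_ae_eq (integrable_inv_sobolevWeight_mul hds a) (mulOp_ae _ a)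

/-- Allows identities between elements of L² to be checked pointwise on representatives. -/
theorem sobolevRep_injective {s : ℝ} (hs : 0 ≤ s) (hds : (d : ℝ) < 2 * s) :
    Function.Injective (sobolevRep s : L2 d → _) := by
  intro a b hab
  refine sobolevEmb_injective hs (Lp.ext ?_)
  exact (sobolevEmb_ae hs hds a).trans (hab ▸ (sobolevEmb_ae hs hds b).symm)

theorem sobolevRep_add {s : ℝ} (hds : (d : ℝ) < 2 * s) (a b : L2 d) :
    sobolevRep s (a + b) = sobolevRep s a + sobolevRep s b := by
  ext x
  have ha := integrable_inv_sobolevWeight_mul hds a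
  have hb := integrable_inv_sobolevWeight_mul hds b
  rw [Pi.add_apply, sobolevRep, sobolevRep, sobolevRep, Real.fourierInv_eq_fourier_comp_neg,
    Real.fourierInv_eq_fourier_comp_neg, Real.fourierInv_eq_fourier_comp_neg]
  rw [← Pi.add_apply]
  have h := VectorFourier.fourierIntegral_add (L := innerₗ (EuclideanSpace ℝ (Fin d)))
    Real.continuous_fourierChar (by exact continuous_inner) ha.comp_neg hb.comp_neg
  refine Eq.trans ?_ (congrFun h x)
  refine Real.fourier_congr_ae ?_ x
  have h2 : ∀ᵐ ξ ∂(volume : Measure (EuclideanSpace ℝ (Fin d))),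
      (a + b : L2 d) (-ξ) = a (-ξ) + b (-ξ) :=
    (Measure.measurePreserving_neg volume).quasiMeasurePreserving.ae (Lp.coeFn_add a b)
  filter_upwards [h2] with ξ h
  rw [h, mul_add, Pi.add_apply]

theorem sobolevRep_smul (s : ℝ) (c : ℂ) (a : L2 d) :
    sobolevRep s (c • a) = c • sobolevRep s a := by
  ext x
  rw [Pi.smul_apply, sobolevRep, sobolevRep, Real.fourierInv_eq, Real.fourierInv_eq,
    ← integral_smul]
  refine integral_congr_ae ?_
  filter_upwards [Lp.coeFn_smul c a] with ξ h
  simp only [h, Pi.smul_apply, smul_eq_mul, Circle.smul_def]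
  ring

/-- Conjugation in x is ξ ↦ conj (a(-ξ)) on the Fourier side, and the weight is even. -/
theorem exists_sobolevRep_conj {s : ℝ} (a : L2 d) :
    ∃ c : L2 d, ‖c‖ = ‖a‖ ∧ ∀ x, sobolevRep s c x = (starRingEnd ℂ) (sobolevRep s a x) := by
  have hneg := Measure.measurePreserving_neg (volume : Measure (EuclideanSpace ℝ (Fin d)))
  have hm : MemLp (fun ξ => (starRingEnd ℂ) (a (-ξ))) 2 volume :=
    (((Lp.memLp a).comp_measurePreserving hneg).star)
  refine ⟨hm.toLp _, ?_, fun x => ?_⟩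
  · rw [Lp.norm_toLp, Lp.norm_def]
    congr 1
    rw [← eLpNorm_comp_measurePreserving (Lp.aestronglyMeasurable a) hneg]
    refine eLpNorm_congr_norm_ae (Eventually.of_forall fun ξ => ?_)
    simp
  · rw [sobolevRep, sobolevRep, Real.fourierInv_eq', Real.fourierInv_eq', ← integral_conj,
      ← integral_neg_eq_self]
    refine integral_congr_ae ?_
    filter_upwards [hneg.quasiMeasurePreserving.ae hm.coeFn_toLp] with ξ h
    simp only [h, smul_eq_mul, map_mul, Complex.conj_ofReal, ← Complex.exp_conj, Complex.conj_I,
      inner_neg_left, neg_neg, sobolevWeight, norm_neg]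
    congr 2
    push_cast
    ring

theorem ENNReal.lintegral_mul_sq_le {β : Type*} [MeasurableSpace β] {μ : Measure β}
    {f g : β → ℝ≥0∞} (hf : AEMeasurable f μ) (hg : AEMeasurable g μ) :
    (∫⁻ x, f x * g x ∂μ) ^ 2 ≤ (∫⁻ x, f x ^ 2 ∂μ) * ∫⁻ x, g x ^ 2 ∂μ := by
  have h := ENNReal.lintegral_mul_le_Lp_mul_Lq μ Real.HolderConjugate.two_two hf hg
  calc (∫⁻ x, f x * g x ∂μ) ^ 2 ≤ _ := pow_le_pow_left' h 2
    _ = _ := by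
      rw [mul_pow, ← ENNReal.rpow_two, ← ENNReal.rpow_two, ← ENNReal.rpow_mul, ← ENNReal.rpow_mul]
      simp

/-- The larger of the frequencies η and ξ - η carries the weight at ξ. With A, B their symbols, 1 +
4π²|ξ|² ≤ 2A + 2B ≤ 4 max(A, B), whence the factor 4^s. -/
theorem sobolevWeight_sq_mul_le {s : ℝ} (hs : 0 ≤ s) (ξ η : EuclideanSpace ℝ (Fin d)) :
    sobolevWeight s ξ ^ 2 * ((sobolevWeight s η)⁻¹ ^ 2 * (sobolevWeight s (ξ - η))⁻¹ ^ 2) ≤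
      4 ^ s * ((sobolevWeight s η)⁻¹ ^ 2 + (sobolevWeight s (ξ - η))⁻¹ ^ 2) := by
  have hsq : ∀ ζ : EuclideanSpace ℝ (Fin d),
      sobolevWeight s ζ ^ 2 = (1 + 4 * Real.pi ^ 2 * ‖ζ‖ ^ 2) ^ s := fun ζ => by
    rw [sobolevWeight, ← Real.rpow_natCast, ← Real.rpow_mul (by positivity)]
    congr 1; push_cast; ring
  have hη := sobolevWeight_pos s η
  have hξη := sobolevWeight_pos s (ξ - η)
  have key : sobolevWeight s ξ ^ 2 ≤
      4 ^ s * (sobolevWeight s η ^ 2 + sobolevWeight s (ξ - η) ^ 2) := by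
    rw [hsq, hsq, hsq]
    set A := 1 + 4 * Real.pi ^ 2 * ‖η‖ ^ 2 with hA
    set B := 1 + 4 * Real.pi ^ 2 * ‖ξ - η‖ ^ 2 with hB
    have hA0 : 0 < A := by positivity
    have hB0 : 0 < B := by positivity
    have htri : ‖ξ‖ ^ 2 ≤ 2 * (‖η‖ ^ 2 + ‖ξ - η‖ ^ 2) := by
      have h1 : ‖ξ‖ ≤ ‖η‖ + ‖ξ - η‖ := by simpa using norm_add_le η (ξ - η)
      nlinarith [sq_nonneg (‖η‖ - ‖ξ - η‖), norm_nonneg ξ, norm_nonneg η, norm_nonneg (ξ - η)]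
    have h2 : 1 + 4 * Real.pi ^ 2 * ‖ξ‖ ^ 2 ≤ 4 * max A B := by
      have h3 : 1 + 4 * Real.pi ^ 2 * ‖ξ‖ ^ 2 ≤ 2 * A + 2 * B := by
        have := mul_le_mul_of_nonneg_left htri (by positivity : 0 ≤ 4 * Real.pi ^ 2)
        rw [hA, hB]; nlinarith
      linarith [le_max_left A B, le_max_right A B]
    calc (1 + 4 * Real.pi ^ 2 * ‖ξ‖ ^ 2) ^ s ≤ (4 * max A B) ^ s :=
          Real.rpow_le_rpow (by positivity) h2 hs
      _ = 4 ^ s * max A B ^ s := Real.mul_rpow (by norm_num) (by positivity)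
      _ ≤ 4 ^ s * (A ^ s + B ^ s) := by
          gcongr
          rcases max_cases A B with ⟨h, _⟩ | ⟨h, _⟩ <;> rw [h]
          · linarith [Real.rpow_nonneg hB0.le s]
          · linarith [Real.rpow_nonneg hA0.le s]
  calc sobolevWeight s ξ ^ 2 * ((sobolevWeight s η)⁻¹ ^ 2 * (sobolevWeight s (ξ - η))⁻¹ ^ 2)
      ≤ 4 ^ s * (sobolevWeight s η ^ 2 + sobolevWeight s (ξ - η) ^ 2) *
        ((sobolevWeight s η)⁻¹ ^ 2 * (sobolevWeight s (ξ - η))⁻¹ ^ 2) := by gcongr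
    _ = _ := by field_simp; ring

/-- The algebra property of `H^s` for `s > d/2`. -/
theorem exists_sobolevRep_mul {s : ℝ} (hds : (d : ℝ) < 2 * s) :
    ∃ K : ℝ, ∀ a b : L2 d, ∃ c : L2 d, ‖c‖ ≤ K * ‖a‖ * ‖b‖ ∧
      ∀ x, sobolevRep s c x = sobolevRep s a x * sobolevRep s b x := by
  have hs : 0 ≤ s := by
    have : (0 : ℝ) ≤ d := by positivity
    linarith
  set W : EuclideanSpace ℝ (Fin d) → ℝ≥0∞ := fun ξ => ENNReal.ofReal (sobolevWeight s ξ) with hW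
  set V : EuclideanSpace ℝ (Fin d) → ℝ≥0∞ := fun ξ => ENNReal.ofReal (sobolevWeight s ξ)⁻¹ with hV
  have hWm : Measurable W := (continuous_sobolevWeight s).measurable.ennreal_ofReal
  have hVm : Measurable V := (continuous_sobolevWeight s).measurable.inv.ennreal_ofReal
  set I : ℝ≥0∞ := ∫⁻ ξ, V ξ ^ 2 with hI
  have hIfin : I < ∞ := by
    refine lt_of_eq_of_lt (lintegral_congr fun ξ => ?_)
      (lintegral_inv_sobolevWeight_sq_lt_top hds)
    rw [hV, ENNReal.ofReal_pow (inv_nonneg.mpr (sobolevWeight_pos s ξ).le)]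
  set C : ℝ≥0∞ := ENNReal.ofReal (4 ^ s) * (I + I) with hC
  have hCfin : C < ∞ := ENNReal.mul_lt_top (by simp) (by simp [hIfin])
  -- Each term on the right of the weight inequality integrates to `I` by translation invariance, so
  -- the bound does not depend on ξ.
  have hVW : ∀ ξ, W ξ ^ 2 * ∫⁻ η, (V η * V (ξ - η)) ^ 2 ≤ C := by
    intro ξ
    have hle : ∀ η, W ξ ^ 2 * (V η * V (ξ - η)) ^ 2 ≤
        ENNReal.ofReal (4 ^ s) * (V η ^ 2 + V (ξ - η) ^ 2) := by
      intro η
      have h0 := sobolevWeight_pos s ξ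
      have h1 := sobolevWeight_pos s η
      have h2 := sobolevWeight_pos s (ξ - η)
      simp only [hW, hV]
      rw [← ENNReal.ofReal_mul (by positivity), ← ENNReal.ofReal_pow (by positivity),
        ← ENNReal.ofReal_pow (by positivity), ← ENNReal.ofReal_pow (by positivity),
        ← ENNReal.ofReal_pow (by positivity), ← ENNReal.ofReal_mul (by positivity),
        ← ENNReal.ofReal_add (by positivity) (by positivity),
        ← ENNReal.ofReal_mul (by positivity), mul_pow]
      exact ENNReal.ofReal_le_ofReal (sobolevWeight_sq_mul_le hs ξ η)
    have hm : Measurable fun η => V (ξ - η) ^ 2 := (hVm.comp (by fun_prop)).pow_const 2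
    calc W ξ ^ 2 * ∫⁻ η, (V η * V (ξ - η)) ^ 2
        = ∫⁻ η, W ξ ^ 2 * (V η * V (ξ - η)) ^ 2 := by
          rw [lintegral_const_mul' _ _ (by simp [hW])]
      _ ≤ ∫⁻ η, ENNReal.ofReal (4 ^ s) * (V η ^ 2 + V (ξ - η) ^ 2) := lintegral_mono hle
      _ = C := by
          rw [lintegral_const_mul' _ _ (by simp), lintegral_add_right _ hm,
            lintegral_sub_left_eq_self (fun η => V η ^ 2) ξ]
  refine ⟨(C ^ (1 / 2 : ℝ)).toReal, fun a b => ?_⟩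
  set f : EuclideanSpace ℝ (Fin d) → ℂ := fun ξ => (((sobolevWeight s ξ)⁻¹ : ℝ) : ℂ) * a ξ with hf
  set g : EuclideanSpace ℝ (Fin d) → ℂ := fun ξ => (((sobolevWeight s ξ)⁻¹ : ℝ) : ℂ) * b ξ with hg
  have hfi : Integrable f := integrable_inv_sobolevWeight_mul hds a
  have hgi : Integrable g := integrable_inv_sobolevWeight_mul hds b
  set h : EuclideanSpace ℝ (Fin d) → ℂ := f ⋆[ContinuousLinearMap.mul ℂ ℂ] g with hh
  have hhi : Integrable h := hfi.integrable_convolution _ hgi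
  have ham : Measurable fun ξ => ‖a ξ‖ₑ := (Lp.stronglyMeasurable a).measurable.enorm
  have hbm : Measurable fun ξ => ‖b ξ‖ₑ := (Lp.stronglyMeasurable b).measurable.enorm
  -- Cauchy-Schwarz in η, with the inverse weights separated from `a` and `b`. Tonelli then
  -- integrates the remaining convolution to ‖a‖²‖b‖².
  have hpt : ∀ ξ, ‖(sobolevWeight s ξ : ℂ) * h ξ‖ₑ ^ 2 ≤
      C * ∫⁻ η, ‖a η‖ₑ ^ 2 * ‖b (ξ - η)‖ₑ ^ 2 := by
    intro ξ
    have hVe : ∀ ζ : EuclideanSpace ℝ (Fin d), ‖(((sobolevWeight s ζ)⁻¹ : ℝ) : ℂ)‖ₑ = V ζ := by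
      intro ζ
      rw [← ofReal_norm, Complex.norm_real,
        Real.norm_of_nonneg (inv_nonneg.mpr (sobolevWeight_pos s ζ).le)]
    have hWe : ‖(sobolevWeight s ξ : ℂ)‖ₑ = W ξ := by
      rw [← ofReal_norm, Complex.norm_real, Real.norm_of_nonneg (sobolevWeight_pos s ξ).le]
    have h1 : ‖h ξ‖ₑ ≤ ∫⁻ η, (V η * V (ξ - η)) * (‖a η‖ₑ * ‖b (ξ - η)‖ₑ) := by
      refine (enorm_integral_le_lintegral_enorm _).trans (le_of_eq (lintegral_congr fun η => ?_))
      rw [ContinuousLinearMap.mul_apply', hf, hg, enorm_mul, enorm_mul, enorm_mul, hVe, hVe]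
      ring
    calc ‖(sobolevWeight s ξ : ℂ) * h ξ‖ₑ ^ 2 = W ξ ^ 2 * ‖h ξ‖ₑ ^ 2 := by
          rw [enorm_mul, mul_pow, hWe]
      _ ≤ W ξ ^ 2 * ((∫⁻ η, (V η * V (ξ - η)) ^ 2) *
            ∫⁻ η, (‖a η‖ₑ * ‖b (ξ - η)‖ₑ) ^ 2) := by
          gcongr
          refine (pow_le_pow_left' h1 2).trans (ENNReal.lintegral_mul_sq_le ?_ ?_)
          · exact (hVm.mul (hVm.comp (by fun_prop))).aemeasurable
          · exact (ham.mul (hbm.comp (by fun_prop : Measurable fun η => ξ - η))).aemeasurable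
      _ ≤ C * ∫⁻ η, ‖a η‖ₑ ^ 2 * ‖b (ξ - η)‖ₑ ^ 2 := by
          rw [← mul_assoc]
          simp_rw [mul_pow ‖_‖ₑ]
          gcongr
          exact hVW ξ
  have hnorm : eLpNorm (fun ξ => (sobolevWeight s ξ : ℂ) * h ξ) 2 volume ≤
      C ^ (1 / 2 : ℝ) * ‖a‖ₑ * ‖b‖ₑ := by
    rw [← ENNReal.pow_le_pow_left_iff two_ne_zero, eLpNorm_two_sq]
    calc ∫⁻ ξ, ‖(sobolevWeight s ξ : ℂ) * h ξ‖ₑ ^ 2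
        ≤ ∫⁻ ξ, C * ∫⁻ η, ‖a η‖ₑ ^ 2 * ‖b (ξ - η)‖ₑ ^ 2 := lintegral_mono hpt
      _ = C * ∫⁻ η, ∫⁻ ξ, ‖a η‖ₑ ^ 2 * ‖b (ξ - η)‖ₑ ^ 2 := by
          rw [lintegral_const_mul' _ _ hCfin.ne, lintegral_lintegral_swap]
          refine Measurable.aemeasurable ?_
          exact ((ham.comp measurable_snd).pow_const 2).mul
            ((hbm.comp (measurable_fst.sub measurable_snd)).pow_const 2)
      _ = C * ∫⁻ η, ‖a η‖ₑ ^ 2 * ‖b‖ₑ ^ 2 := by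
          congr 1
          refine lintegral_congr fun η => ?_
          rw [lintegral_const_mul' _ _ (by simp),
            lintegral_sub_right_eq_self (fun ξ => ‖b ξ‖ₑ ^ 2) η, ← eLpNorm_two_sq, Lp.enorm_def]
      _ = (C ^ (1 / 2 : ℝ) * ‖a‖ₑ * ‖b‖ₑ) ^ 2 := by
          rw [lintegral_mul_const' _ _ (by simp), ← eLpNorm_two_sq, ← Lp.enorm_def, mul_pow,
            mul_pow, ← ENNReal.rpow_two (C ^ (1 / 2 : ℝ)), ← ENNReal.rpow_mul]
          norm_num [mul_assoc]
  have hCrt : C ^ (1 / 2 : ℝ) ≠ ∞ := ENNReal.rpow_ne_top_of_nonneg (by norm_num) hCfin.ne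
  have hmem : MemLp (fun ξ => (sobolevWeight s ξ : ℂ) * h ξ) 2 volume := by
    refine ⟨(Complex.continuous_ofReal.comp
      (continuous_sobolevWeight s)).aestronglyMeasurable.mul hhi.aestronglyMeasurable,
      hnorm.trans_lt ?_⟩
    exact ENNReal.mul_lt_top (ENNReal.mul_lt_top hCrt.lt_top (by simp)) (by simp)
  refine ⟨hmem.toLp _, ?_, fun x => ?_⟩
  · rw [Lp.norm_toLp]
    refine (ENNReal.toReal_mono ?_ hnorm).trans (le_of_eq ?_)
    · exact ENNReal.mul_ne_top (ENNReal.mul_ne_top hCrt (by simp)) (by simp)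
    · simp [ENNReal.toReal_mul]
  · have h1 : sobolevRep s (hmem.toLp _) x = 𝓕⁻ h x := by
      refine Real.fourierInv_congr_ae ?_ x
      filter_upwards [hmem.coeFn_toLp] with ξ hξ
      have : (sobolevWeight s ξ : ℂ) ≠ 0 := by exact_mod_cast (sobolevWeight_pos s ξ).ne'
      rw [hξ, Complex.ofReal_inv, inv_mul_cancel_left₀ this]
    rw [h1, sobolevRep, sobolevRep, Real.fourierInv_eq_fourier_neg,
      Real.fourierInv_eq_fourier_neg, Real.fourierInv_eq_fourier_neg, hh,
      Real.fourier_mul_convolution_eq hfi hgi]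

end SobolevProduct

/-! ### The power nonlinearity is Lipschitz on balls of H^s. -/

section PowerNonlinearity

open Metric
open scoped NNReal

variable {d : ℕ}

/-- `f` is Lipschitz on every ball. -/
def IsLipschitzOnBalls {X : Type*} [NormedAddCommGroup X] (f : X → X) : Prop :=
  ∀ R : ℝ, ∃ K : ℝ≥0, LipschitzOnWith K f (closedBall 0 R)

namespace IsLipschitzOnBalls

variable {X : Type*} [NormedAddCommGroup X] {f : X → X}

theorem exists_norm_le (hf : IsLipschitzOnBalls f) (R : ℝ) :
    ∃ C : ℝ≥0, ∀ x ∈ closedBall (0 : X) R, ‖f x‖ ≤ C := by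
  obtain ⟨K, hK⟩ := hf R
  refine ⟨K * R.toNNReal + ‖f 0‖₊, fun x hx => ?_⟩
  have hx' : ‖x‖ ≤ R := by simpa using hx
  have hR : 0 ≤ R := (norm_nonneg x).trans hx'
  have h1 := hK.dist_le_mul x hx 0 (by simpa using hR)
  rw [dist_eq_norm, dist_zero_right] at h1
  have h2 := norm_sub_norm_le (f x) (f 0)
  have h3 : (K : ℝ) * ‖x‖ ≤ K * R := by gcongr
  push_cast
  rw [Real.coe_toNNReal _ hR]
  linarith

theorem continuous (hf : IsLipschitzOnBalls f) : Continuous f := by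
  refine continuous_iff_continuousAt.mpr fun x => ?_
  obtain ⟨K, hK⟩ := hf (‖x‖ + 1)
  refine hK.continuousOn.continuousAt ?_
  exact mem_of_superset (closedBall_mem_nhds x one_pos)
    (closedBall_subset_closedBall' (by simp; linarith))

end IsLipschitzOnBalls

theorem sobolevRep_sub {s : ℝ} (hds : (d : ℝ) < 2 * s) (a b : L2 d) :
    sobolevRep s (a - b) = sobolevRep s a - sobolevRep s b := by
  rw [sub_eq_add_neg, ← neg_one_smul ℂ b, sobolevRep_add hds, sobolevRep_smul, neg_one_smul,
    ← sub_eq_add_neg]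

theorem IsLipschitzOnBalls.exists_sobolevRep_mul {s : ℝ} (hs : 0 ≤ s) (hds : (d : ℝ) < 2 * s)
    {f g : L2 d → L2 d} (hf : IsLipschitzOnBalls f) (hg : IsLipschitzOnBalls g) :
    ∃ h : L2 d → L2 d, IsLipschitzOnBalls h ∧
      ∀ a x, sobolevRep s (h a) x = sobolevRep s (f a) x * sobolevRep s (g a) x := by
  obtain ⟨K, hK⟩ := _root_.exists_sobolevRep_mul (d := d) hds
  choose M hM hMr using hK
  refine ⟨fun a => M (f a) (g a), fun R => ?_, fun a x => hMr _ _ x⟩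
  obtain ⟨Kf, hKf⟩ := hf R
  obtain ⟨Kg, hKg⟩ := hg R
  obtain ⟨Cf, hCf⟩ := hf.exists_norm_le R
  obtain ⟨Cg, hCg⟩ := hg.exists_norm_le R
  refine ⟨K.toNNReal * (Kf * Cg + Cf * Kg), LipschitzOnWith.of_dist_le_mul fun a ha b hb => ?_⟩
  -- The product `M` is a mere choice; its bilinearity follows from injectivity of representatives.
  have hsplit : M (f a) (g a) - M (f b) (g b) =
      M (f a - f b) (g a) + M (f b) (g a - g b) := by
    refine sobolevRep_injective hs hds (funext fun x => ?_)
    rw [sobolevRep_sub hds, sobolevRep_add hds, Pi.sub_apply, Pi.add_apply, hMr, hMr, hMr, hMr,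
      sobolevRep_sub hds, sobolevRep_sub hds, Pi.sub_apply, Pi.sub_apply]
    ring
  have hKM : ∀ x y, ‖M x y‖ ≤ K.toNNReal * (‖x‖ * ‖y‖) := fun x y => by
    refine (hM x y).trans ?_
    rw [mul_assoc]
    gcongr
    exact Real.le_coe_toNNReal K
  have h1 := hKf.dist_le_mul a ha b hb
  have h2 := hKg.dist_le_mul a ha b hb
  rw [dist_eq_norm (f a)] at h1
  rw [dist_eq_norm (g a)] at h2
  rw [dist_eq_norm, hsplit]
  calc ‖M (f a - f b) (g a) + M (f b) (g a - g b)‖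
      ≤ K.toNNReal * (‖f a - f b‖ * ‖g a‖) + K.toNNReal * (‖f b‖ * ‖g a - g b‖) :=
        (norm_add_le _ _).trans (add_le_add (hKM _ _) (hKM _ _))
    _ ≤ K.toNNReal * ((Kf * dist a b) * Cg) + K.toNNReal * (Cf * (Kg * dist a b)) := by
        gcongr
        · exact hCg a ha
        · exact hCf b hb
    _ = _ := by push_cast; ring

/-- Induction on α: |u|^{2(k+1)} u = (|u|^{2k} u) · u · ū, a product of maps already known to be
Lipschitz on balls. The even exponent makes it a polynomial in u and ū. -/
theorem exists_sobolevRep_power {s : ℝ} (hs : 0 ≤ s) (hds : (d : ℝ) < 2 * s) (α : ℕ) :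
    ∃ N : L2 d → L2 d, IsLipschitzOnBalls N ∧
      ∀ a x, sobolevRep s (N a) x = ((‖sobolevRep s a x‖ ^ (2 * α) : ℝ) : ℂ) * sobolevRep s a x := by
  have hid : IsLipschitzOnBalls (id : L2 d → L2 d) := fun R => ⟨1, LipschitzWith.id.lipschitzOnWith⟩
  choose Q hQ hQr using fun a : L2 d => exists_sobolevRep_conj (s := s) a
  have hQlip : IsLipschitzOnBalls Q := fun R =>
    ⟨1, LipschitzOnWith.of_dist_le_mul fun a _ b _ => by
      have : Q a - Q b = Q (a - b) := by
        refine sobolevRep_injective hs hds (funext fun x => ?_)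
        rw [sobolevRep_sub hds, Pi.sub_apply, hQr, hQr, hQr, sobolevRep_sub hds, Pi.sub_apply,
          map_sub]
      rw [dist_eq_norm, this, hQ, dist_eq_norm]
      simp⟩
  induction α with
  | zero => exact ⟨id, hid, fun a x => by simp⟩
  | succ k ih =>
    obtain ⟨N, hN, hNr⟩ := ih
    obtain ⟨N₁, hN₁, hN₁r⟩ := hN.exists_sobolevRep_mul hs hds hid
    obtain ⟨N₂, hN₂, hN₂r⟩ := hN₁.exists_sobolevRep_mul hs hds hQlip
    refine ⟨N₂, hN₂, fun a x => ?_⟩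
    rw [hN₂r, hN₁r, hNr, hQr, id, mul_assoc, Complex.mul_conj, Complex.normSq_eq_norm_sq,
      mul_add, pow_add]
    push_cast
    ring

/-- The power nonlinearity maps `H^s`, `s > d/2`, to itself and is Lipschitz on balls there. -/
theorem exists_powerNL_sobolevEmb {s : ℝ} (hs : 0 ≤ s) (hds : (d : ℝ) < 2 * s) (α : ℕ) :
    ∃ N : L2 d → L2 d, IsLipschitzOnBalls N ∧
      ∀ a, powerNL α (sobolevEmb hs a) = sobolevEmb hs (N a) := by
  obtain ⟨N, hN, hNr⟩ := exists_sobolevRep_power (d := d) hs hds α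
  refine ⟨N, hN, fun a => ?_⟩
  have hae : (fun x => ((‖sobolevEmb hs a x‖ ^ (2 * α) : ℝ) : ℂ) * sobolevEmb hs a x)
      =ᵐ[volume] sobolevEmb hs (N a) := by
    filter_upwards [sobolevEmb_ae hs hds a, sobolevEmb_ae hs hds (N a)] with x h1 h2
    rw [h1, h2, hNr]
  have hmem := (memLp_congr_ae hae).mpr (Lp.memLp (sobolevEmb hs (N a)))
  -- The default value of `powerNL` is never taken on H^s.
  rw [powerNL, dif_pos hmem]
  exact Lp.ext (hmem.coeFn_toLp.trans hae)

end PowerNonlinearity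

/-! ### Removing the free flow by conjugation. -/

section InteractionPicture

open Metric
open scoped NNReal

variable {X : Type*} [NormedAddCommGroup X] [NormedSpace ℂ X]

/-- A strongly continuous one-parameter group of linear isometries. -/
structure IsIsometryGroup (S : ℝ → X →L[ℂ] X) : Prop where
  norm_map : ∀ r x, ‖S r x‖ = ‖x‖
  map_add : ∀ r r' x, S (r + r') x = S r (S r' x)
  map_zero : ∀ x, S 0 x = x
  cont : Continuous fun p : ℝ × X => S p.1 p.2

namespace IsIsometryGroup

variable {S : ℝ → X →L[ℂ] X}

theorem apply_neg_cancel (hS : IsIsometryGroup S) (r : ℝ) (x : X) : S r (S (-r) x) = x := by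
  rw [← hS.map_add, add_neg_cancel, hS.map_zero]

theorem dist_map (hS : IsIsometryGroup S) (r : ℝ) (x y : X) : dist (S r x) (S r y) = dist x y := by
  rw [dist_eq_norm, ← map_sub, hS.norm_map, dist_eq_norm]

theorem injective (hS : IsIsometryGroup S) (r : ℝ) : Function.Injective (S r) := fun x y h => by
  rw [← dist_eq_zero, ← hS.dist_map r, h, dist_self]

theorem continuousOn (hS : IsIsometryGroup S) {θ : ℝ → ℝ} {b : ℝ → X} {J : Set ℝ}
    (hθ : ContinuousOn θ J) (hb : ContinuousOn b J) : ContinuousOn (fun t => S (θ t) (b t)) J :=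
  hS.cont.comp_continuousOn (hθ.prodMk hb)

end IsIsometryGroup

/-- The nonlinearity `N` conjugated by the free flow at the accumulated dispersion `r`. -/
noncomputable def interactionField (S : ℝ → X →L[ℂ] X) (N : X → X) (r : ℝ) (x : X) : X :=
  Complex.I • S (-r) (N (S r x))

variable {S : ℝ → X →L[ℂ] X} {N : X → X}

theorem continuous_interactionField (hS : IsIsometryGroup S) (hN : Continuous N) :
    Continuous fun p : ℝ × X => interactionField S N p.1 p.2 := by
  have h : Continuous fun p : ℝ × X => S (-p.1) (N (S p.1 p.2)) :=
    hS.cont.comp (continuous_fst.neg.prodMk (hN.comp hS.cont))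
  exact h.const_smul Complex.I

theorem lipschitzOnWith_interactionField (hS : IsIsometryGroup S) {K : ℝ≥0} {R : ℝ}
    (hN : LipschitzOnWith K N (closedBall 0 R)) (r : ℝ) :
    LipschitzOnWith K (interactionField S N r) (closedBall 0 R) := by
  have hmem : ∀ x ∈ closedBall (0 : X) R, S r x ∈ closedBall (0 : X) R := by
    intro x hx
    rw [mem_closedBall_zero_iff] at hx ⊢
    rwa [hS.norm_map]
  refine LipschitzOnWith.of_dist_le_mul fun x hx y hy => ?_
  have h := hN.dist_le_mul _ (hmem x hx) _ (hmem y hy)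
  rw [hS.dist_map] at h
  rwa [interactionField, interactionField, dist_smul₀, Complex.norm_I, one_mul, hS.dist_map]

theorem isUniformLipschitzField_interactionField (hS : IsIsometryGroup S)
    (hN : IsLipschitzOnBalls N) {θ : ℝ → ℝ} (hθ : Continuous θ) :
    IsUniformLipschitzField fun t => interactionField S N (θ t) := by
  refine ⟨?_, fun R => ?_, fun R => ?_⟩
  · exact (continuous_interactionField hS hN.continuous).comp
      ((hθ.comp continuous_fst).prodMk continuous_snd)
  · obtain ⟨K, hK⟩ := hN R
    exact ⟨K, fun t => lipschitzOnWith_interactionField hS hK (θ t)⟩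
  · obtain ⟨C, hC⟩ := hN.exists_norm_le R
    refine ⟨C, fun t x hx => ?_⟩
    rw [interactionField, norm_smul, Complex.norm_I, one_mul, hS.norm_map]
    refine hC _ ?_
    rw [mem_closedBall_zero_iff] at hx ⊢
    rwa [hS.norm_map]

/-- Duhamel's integral in the interaction picture. -/
theorem integral_duhamel_eq [NormedSpace ℝ X] [SMulCommClass ℝ ℂ X] [CompleteSpace X] (hS : IsIsometryGroup S) (hN : Continuous N)
    {Y : Type*} [NormedAddCommGroup Y] [NormedSpace ℝ Y] [NormedSpace ℂ Y] [SMulCommClass ℝ ℂ Y]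
    [CompleteSpace Y] (L : X →L[ℂ] Y) {g : ℝ → ℝ} (hg : ∀ a b, IntervalIntegrable g volume a b)
    {t₀ t : ℝ} (ht : t₀ ≤ t) {b : ℝ → X} (hb : ContinuousOn b (Icc t₀ t)) :
    Complex.I • ∫ r in t₀..t, L (S (∫ τ in r..t, g τ) (N (S (∫ τ in t₀..r, g τ) (b r)))) =
      L (S (∫ τ in t₀..t, g τ)
        (∫ r in t₀..t, interactionField S N (∫ τ in t₀..r, g τ) (b r))) := by
  have hθ : Continuous fun r => ∫ τ in t₀..r, g τ := intervalIntegral.continuous_primitive hg t₀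
  have hint : IntervalIntegrable (fun r => interactionField S N (∫ τ in t₀..r, g τ) (b r))
      volume t₀ t :=
    ((continuous_interactionField hS hN).comp_continuousOn
      (hθ.continuousOn.prodMk hb)).intervalIntegrable_of_Icc ht
  have hcomm := ContinuousLinearMap.intervalIntegral_comp_comm
    (L ∘L S (∫ τ in t₀..t, g τ)) hint
  rw [ContinuousLinearMap.comp_apply] at hcomm
  rw [← hcomm, ← intervalIntegral.integral_smul]
  refine intervalIntegral.integral_congr fun r hr => ?_
  -- By the group law S(θ(t) - θ(r)) = S(θ(t)) S(-θ(r)), so the factor depending on `t` leaves the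
  -- integral.
  have hsub : ∫ τ in r..t, g τ = (∫ τ in t₀..t, g τ) + -∫ τ in t₀..r, g τ := by
    rw [← sub_eq_add_neg, intervalIntegral.integral_interval_sub_left (hg _ _) (hg _ _)]
  simp only [ContinuousLinearMap.comp_apply]
  rw [hsub, hS.map_add, interactionField, map_smul, map_smul]

end InteractionPicture

/-! ### Equivalence of H^σ solutions with solutions of the integral equation in L². -/

section SobolevSolutions

variable {d : ℕ}

theorem isIsometryGroup_schrodingerMul : IsIsometryGroup (schrodingerMul (d := d)) :=
  ⟨norm_schrodingerMul, schrodingerMul_add, schrodingerMul_zero, continuous_schrodingerMul⟩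

theorem duhamel_eq_sobolevEmb {s : ℝ} (hs : 0 ≤ s) {α : ℕ} {N : L2 d → L2 d}
    (hNc : Continuous N) (hN : ∀ a, powerNL α (sobolevEmb hs a) = sobolevEmb hs (N a))
    {g : ℝ → ℝ} (hg : ∀ a b, IntervalIntegrable g volume a b) {t₀ t : ℝ} (ht : t₀ ≤ t)
    (a₀ : L2 d) {b u : ℝ → L2 d} (hb : ContinuousOn b (Icc t₀ t))
    (hu : ∀ r ∈ Icc t₀ t, u r = sobolevEmb hs (schrodingerMul (∫ τ in t₀..r, g τ) (b r))) :
    schrodingerOp (∫ τ in t₀..t, g τ) (sobolevEmb hs a₀) +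
      Complex.I • ∫ r in t₀..t, schrodingerOp (∫ τ in r..t, g τ) (powerNL α (u r)) =
    sobolevEmb hs (schrodingerMul (∫ τ in t₀..t, g τ)
      (a₀ + ∫ r in t₀..t, interactionField schrodingerMul N (∫ τ in t₀..r, g τ) (b r))) := by
  rw [(schrodingerMul _).map_add, (sobolevEmb hs).map_add, schrodingerOp_sobolevEmb,
    ← integral_duhamel_eq isIsometryGroup_schrodingerMul hNc (sobolevEmb hs) hg ht hb]
  congr 2
  refine intervalIntegral.integral_congr fun r hr => ?_
  rw [uIcc_of_le ht] at hr
  rw [hu r hr, hN, schrodingerOp_sobolevEmb]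

theorem hsNorm_sobolevEmb_sub {s : ℝ} (hs : 0 ≤ s) (a b : L2 d) :
    hsNorm s (sobolevEmb hs a - sobolevEmb hs b) = edist a b := by
  rw [← (sobolevEmb hs).map_sub, hsNorm_sobolevEmb, edist_eq_enorm_sub]

variable {σ α : ℕ} {N : L2 d → L2 d} {g : ℝ → ℝ} {t₀ : ℝ} {a₀ : L2 d}

theorem IsIntegralSolution.isNLSSolution
    (hNc : Continuous N)
    (hN : ∀ a, powerNL α (sobolevEmb (Nat.cast_nonneg σ) a) = sobolevEmb (Nat.cast_nonneg σ) (N a))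
    (hg : ∀ a b, IntervalIntegrable g volume a b) {J : Set ℝ} (hJ : ∀ t ∈ J, t₀ ≤ t ∧ Icc t₀ t ⊆ J)
    {b : ℝ → L2 d}
    (hb : IsIntegralSolution (fun t => interactionField schrodingerMul N (∫ τ in t₀..t, g τ)) t₀ a₀ J b) :
    IsNLSSolution σ α g t₀ (sobolevEmb (Nat.cast_nonneg σ) a₀) J fun t =>
      sobolevEmb (Nat.cast_nonneg σ) (schrodingerMul (∫ τ in t₀..t, g τ) (b t)) := by
  have hθ : Continuous fun r => ∫ τ in t₀..r, g τ := intervalIntegral.continuous_primitive hg t₀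
  refine ⟨fun t _ => memHs_sobolevEmb _ _, fun t ht => ?_, fun t ht => ?_⟩
  · simp_rw [hsNorm_sobolevEmb_sub]
    rw [← tendsto_iff_edist_tendsto_0]
    exact isIsometryGroup_schrodingerMul.continuousOn hθ.continuousOn hb.cont t ht
  · rw [duhamel_eq_sobolevEmb _ hNc hN hg (hJ t ht).1 a₀ (hb.cont.mono (hJ t ht).2)
      fun r _ => rfl]
    rw [hb.eq t ht]

theorem IsNLSSolution.exists_isIntegralSolution
    (hNc : Continuous N)
    (hN : ∀ a, powerNL α (sobolevEmb (Nat.cast_nonneg σ) a) = sobolevEmb (Nat.cast_nonneg σ) (N a))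
    (hg : ∀ a b, IntervalIntegrable g volume a b) {J : Set ℝ} (hJ : ∀ t ∈ J, t₀ ≤ t ∧ Icc t₀ t ⊆ J)
    {u : ℝ → L2 d} (hu : IsNLSSolution σ α g t₀ (sobolevEmb (Nat.cast_nonneg σ) a₀) J u) :
    ∃ b, IsIntegralSolution (fun t => interactionField schrodingerMul N (∫ τ in t₀..t, g τ)) t₀ a₀ J b ∧
      ∀ t ∈ J, u t = sobolevEmb (Nat.cast_nonneg σ) (schrodingerMul (∫ τ in t₀..t, g τ) (b t)) := by
  have hθ : Continuous fun r => ∫ τ in t₀..r, g τ := intervalIntegral.continuous_primitive hg t₀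
  choose! a ha using fun t ht => exists_sobolevEmb_eq (Nat.cast_nonneg σ) (hu.mem t ht)
  have hac : ContinuousOn a J := by
    intro t ht
    rw [ContinuousWithinAt, tendsto_iff_edist_tendsto_0]
    refine (hu.cont t ht).congr' ?_
    filter_upwards [self_mem_nhdsWithin] with r hr
    rw [← ha r hr, ← ha t ht, hsNorm_sobolevEmb_sub]
  -- Undoing the free flow; Duhamel's formula for `u` then gives the integral equation for `b`
  -- because the embedding and the group are injective.
  set b : ℝ → L2 d := fun t => schrodingerMul (-∫ τ in t₀..t, g τ) (a t) with hb
  have hbc : ContinuousOn b J :=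
    isIsometryGroup_schrodingerMul.continuousOn hθ.neg.continuousOn hac
  have hub : ∀ t ∈ J, u t =
      sobolevEmb (Nat.cast_nonneg σ) (schrodingerMul (∫ τ in t₀..t, g τ) (b t)) := fun t ht => by
    rw [hb, isIsometryGroup_schrodingerMul.apply_neg_cancel, ha t ht]
  refine ⟨b, ⟨hbc, fun t ht => ?_⟩, hub⟩
  have h := hu.duhamel t ht
  rw [duhamel_eq_sobolevEmb _ hNc hN hg (hJ t ht).1 a₀ (hbc.mono (hJ t ht).2)
    fun r hr => hub r ((hJ t ht).2 hr), hub t ht] at h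
  have h' := sobolevEmb_injective _ h
  exact isIsometryGroup_schrodingerMul.injective _ h'

theorem mem_and_Icc_subset_of_mem_Icc {T : ℝ} :
    ∀ t ∈ Icc t₀ T, t₀ ≤ t ∧ Icc t₀ t ⊆ Icc t₀ T :=
  fun _ ht => ⟨ht.1, Icc_subset_Icc_right ht.2⟩

theorem mem_and_Icc_subset_of_coe_lt {Tmax : EReal} :
    ∀ t ∈ {t : ℝ | t₀ ≤ t ∧ (t : EReal) < Tmax}, t₀ ≤ t ∧
      Icc t₀ t ⊆ {t : ℝ | t₀ ≤ t ∧ (t : EReal) < Tmax} :=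
  fun _ ht => ⟨ht.1, fun _ hr => ⟨hr.1, lt_of_le_of_lt (EReal.coe_le_coe_iff.mpr hr.2) ht.2⟩⟩

theorem tendsto_enorm_nhds_top_iff {ι : Type*} {l : Filter ι} {b : ι → L2 d} :
    Tendsto (fun t => ‖b t‖ₑ) l (𝓝 ∞) ↔ Tendsto (fun t => ‖b t‖) l atTop := by
  simp_rw [← ofReal_norm]
  exact ENNReal.tendsto_ofReal_nhds_top

theorem IsMaximalNLSSolution.exists_isMaximalIntegralSolution
    (hNc : Continuous N)
    (hN : ∀ a, powerNL α (sobolevEmb (Nat.cast_nonneg σ) a) = sobolevEmb (Nat.cast_nonneg σ) (N a))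
    (hg : ∀ a b, IntervalIntegrable g volume a b) {Tmax : EReal} {u : ℝ → L2 d}
    (hu : IsMaximalNLSSolution σ α g t₀ (sobolevEmb (Nat.cast_nonneg σ) a₀) Tmax u) :
    ∃ b, IsMaximalIntegralSolution (fun t => interactionField schrodingerMul N (∫ τ in t₀..t, g τ)) t₀ a₀ Tmax b ∧
      ∀ t, t₀ ≤ t → (t : EReal) < Tmax →
        u t = sobolevEmb (Nat.cast_nonneg σ) (schrodingerMul (∫ τ in t₀..t, g τ) (b t)) := by
  obtain ⟨b, hb, hub⟩ := hu.isSolution.exists_isIntegralSolution hNc hN hg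
    mem_and_Icc_subset_of_coe_lt
  refine ⟨b, ⟨hu.lt, hb, fun T hT => ?_⟩, fun t h1 h2 => hub t ⟨h1, h2⟩⟩
  rw [← tendsto_enorm_nhds_top_iff]
  refine (hu.blowup T hT).congr' ?_
  have ht₀ : t₀ < T := by
    have := hu.lt
    rw [hT] at this
    exact_mod_cast this
  filter_upwards [Ioo_mem_nhdsLT ht₀] with t ht
  rw [hub t ⟨ht.1.le, by rw [hT]; exact_mod_cast ht.2⟩, hsNorm_sobolevEmb, enorm_eq_nnnorm,
    enorm_eq_nnnorm]
  congr 1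
  exact NNReal.eq (norm_schrodingerMul _ _)

theorem hasUniqueMaximalNLSSolution_of_isLipschitzOnBalls
    (hNl : IsLipschitzOnBalls N)
    (hN : ∀ a, powerNL α (sobolevEmb (Nat.cast_nonneg σ) a) = sobolevEmb (Nat.cast_nonneg σ) (N a))
    (hg : ∀ a b, IntervalIntegrable g volume a b) :
    HasUniqueMaximalNLSSolution σ α g t₀ (sobolevEmb (Nat.cast_nonneg σ) a₀) := by
  have hθ : Continuous fun r => ∫ τ in t₀..r, g τ := intervalIntegral.continuous_primitive hg t₀
  obtain ⟨Tmax, b, hb, huniq⟩ :=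
    (isUniformLipschitzField_interactionField isIsometryGroup_schrodingerMul hNl hθ).exists_maximal t₀ a₀
  refine ⟨Tmax, _, ⟨hb.lt, hb.isSolution.isNLSSolution hNl.continuous hN hg
    mem_and_Icc_subset_of_coe_lt, fun T hT => ?_⟩, fun T v hT hv => ?_⟩
  · have h := tendsto_enorm_nhds_top_iff.mpr (hb.blowup T hT)
    refine h.congr fun t => ?_
    rw [hsNorm_sobolevEmb, enorm_eq_nnnorm, enorm_eq_nnnorm]
    congr 1
    exact (NNReal.eq (norm_schrodingerMul _ _)).symm
  · obtain ⟨c, hc, hvc⟩ := hv.exists_isIntegralSolution hNl.continuous hN hg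
      mem_and_Icc_subset_of_mem_Icc
    obtain ⟨h1, h2⟩ := huniq T c hT hc
    refine ⟨h1, fun t ht => ?_⟩
    rw [hvc t ht, h2 ht]

end SobolevSolutions

/-! ### Averaging of the dispersion and convergence of solutions. -/

section Averaging

open Metric
open scoped NNReal

theorem measurable_dispersionMap (γp γm tp : ℝ) : Measurable (dispersionMap γp γm tp) := by
  have : Measurable fun τ : ℝ => τ - ⌈τ⌉ + 1 :=
    (measurable_id.sub (measurable_from_top.comp Int.measurable_ceil)).add_const 1
  exact Measurable.ite (measurableSet_le this measurable_const) measurable_const measurable_const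

theorem abs_dispersionMap_le (γp γm tp τ : ℝ) :
    |dispersionMap γp γm tp τ| ≤ max |γp| |γm| := by
  unfold dispersionMap
  split_ifs <;> simp

theorem periodic_dispersionMap (γp γm tp : ℝ) : Function.Periodic (dispersionMap γp γm tp) 1 := by
  intro τ
  have : τ + 1 - ((⌈τ⌉ + 1 : ℤ) : ℝ) + 1 = τ - ⌈τ⌉ + 1 := by push_cast; ring
  rw [dispersionMap, dispersionMap, Int.ceil_add_one, this]

theorem intervalIntegrable_dispersionMap_comp (γp γm tp : ℝ) {h : ℝ → ℝ} (hh : Measurable h)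
    (a b : ℝ) : IntervalIntegrable (fun t => dispersionMap γp γm tp (h t)) volume a b := by
  refine (intervalIntegrable_const (c := max |γp| |γm|)).mono_fun
    ((measurable_dispersionMap γp γm tp).comp hh).aestronglyMeasurable
    (Eventually.of_forall fun t => ?_)
  rw [Real.norm_eq_abs]
  exact (abs_dispersionMap_le _ _ _ _).trans (le_abs_self _)

/-- The primitive of a rapidly oscillating periodic function is close to that of its mean. -/
theorem Function.Periodic.exists_abs_integral_comp_div_sub_le {γ : ℝ → ℝ}
    (hγ : Function.Periodic γ 1) (hi : ∀ a b, IntervalIntegrable γ volume a b) :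
    ∃ B : ℝ, ∀ ε > 0, ∀ a b : ℝ,
      |(∫ τ in a..b, γ (τ / ε)) - ∫ _ in a..b, averageDispersion γ| ≤ ε * B := by
  set m := averageDispersion γ with hm
  have hi' : ∀ a b, IntervalIntegrable (fun τ => γ τ - m) volume a b := fun a b =>
    (hi a b).sub intervalIntegrable_const
  set Φ : ℝ → ℝ := fun x => ∫ τ in (0 : ℝ)..x, (γ τ - m) with hΦ
  have hΦc : Continuous Φ := intervalIntegral.continuous_primitive hi' 0
  have hper : Function.Periodic (fun τ => γ τ - m) 1 := fun τ => by simp only [hγ τ]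
  -- Subtracting the mean makes the integral over a period vanish; the primitive is periodic and
  -- continuous, hence bounded.
  have hΦp : Function.Periodic Φ 1 := by
    intro x
    have h0 : ∫ τ in x..x + 1, (γ τ - m) = 0 := by
      rw [hper.intervalIntegral_add_eq x 0, zero_add, intervalIntegral.integral_sub (hi 0 1)
        intervalIntegrable_const, hm, averageDispersion]
      simp
    simp only [hΦ]
    rw [← intervalIntegral.integral_add_adjacent_intervals (hi' 0 x) (hi' x (x + 1)), h0, add_zero]
  obtain ⟨B, hB⟩ : ∃ B, ∀ x, |Φ x| ≤ B := by
    obtain ⟨B, hB⟩ := (hΦp.compact_of_continuous one_ne_zero hΦc).isBounded.exists_norm_le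
    exact ⟨B, fun x => hB _ (mem_range_self x)⟩
  refine ⟨2 * B, fun ε hε a b => ?_⟩
  -- Rescaling time by `ε` produces the gain `ε` in front of the bounded primitive.
  have hcomp : (∫ τ in a..b, γ (τ / ε)) - ∫ _ in a..b, m = ε * (Φ (b / ε) - Φ (a / ε)) := by
    have h1 : ∫ τ in a..b, γ (τ / ε) = ε * ∫ τ in a / ε..b / ε, γ τ := by
      rw [intervalIntegral.integral_comp_div γ hε.ne', smul_eq_mul]
    have h2 : Φ (b / ε) - Φ (a / ε) = ∫ τ in a / ε..b / ε, (γ τ - m) :=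
      intervalIntegral.integral_interval_sub_left (hi' _ _) (hi' _ _)
    rw [h1, h2, intervalIntegral.integral_sub (hi _ _) intervalIntegrable_const]
    simp only [intervalIntegral.integral_const, smul_eq_mul]
    field_simp
  rw [hcomp, abs_mul, abs_of_pos hε]
  gcongr
  have h3 := abs_sub (Φ (b / ε)) (Φ (a / ε))
  linarith [hB (b / ε), hB (a / ε)]

/-- Joint continuity is uniform at the points of the compact curve t ↦ (θ(t), c(t)). This replaces
the missing continuity in r uniform over balls. -/
theorem exists_pos_forall_norm_sub_lt {X Y : Type*} [NormedAddCommGroup X] [NormedAddCommGroup Y]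
    {Ψ : ℝ → X → Y} (hΨ : Continuous fun p : ℝ × X => Ψ p.1 p.2) {θ : ℝ → ℝ} {c : ℝ → X}
    {S : Set ℝ} (hS : IsCompact S) (hθ : ContinuousOn θ S) (hc : ContinuousOn c S)
    {δ : ℝ} (hδ : 0 < δ) :
    ∃ r > 0, ∀ t ∈ S, ∀ r', |r' - θ t| < r → ‖Ψ r' (c t) - Ψ (θ t) (c t)‖ < δ := by
  have hK : IsCompact ((fun t => (θ t, c t)) '' S) := hS.image_of_continuousOn (hθ.prodMk hc)
  have h := hK.uniformContinuousAt_of_continuousAt (fun p : ℝ × X => Ψ p.1 p.2)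
    (fun p _ => hΨ.continuousAt) (dist_mem_uniformity hδ)
  obtain ⟨r, hr, hr'⟩ := Metric.mem_uniformity_dist.mp h
  refine ⟨r, hr, fun t ht x hx => ?_⟩
  have h1 : dist ((θ t, c t) : ℝ × X) (x, c t) < r := by
    rw [Prod.dist_eq, dist_self, dist_comm, Real.dist_eq]
    exact max_lt hx hr
  have h2 := hr' h1 (mem_image_of_mem _ ht)
  rw [mem_ofPred_eq] at h2
  rwa [dist_comm, dist_eq_norm] at h2

/-- Convergence of the solutions in `H^σ` as the accumulated dispersions converge. -/
theorem eventually_hsNorm_sub_le {d σ α : ℕ} {N : L2 d → L2 d} (hNl : IsLipschitzOnBalls N)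
    (hN : ∀ a, powerNL α (sobolevEmb (Nat.cast_nonneg σ) a) = sobolevEmb (Nat.cast_nonneg σ) (N a))
    {ι : Type*} {l : Filter ι} {g₀ : ℝ → ℝ} {g : ι → ℝ → ℝ}
    (hg₀ : ∀ a b, IntervalIntegrable g₀ volume a b)
    {t₀ T : ℝ} (hT : t₀ ≤ T) {a₀ : L2 d} {Tstar : EReal} {u₀ : ℝ → L2 d} {Tmax : ι → EReal}
    {u : ι → ℝ → L2 d}
    (hu₀ : IsMaximalNLSSolution σ α g₀ t₀ (sobolevEmb (Nat.cast_nonneg σ) a₀) Tstar u₀)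
    (hTstar : (T : EReal) < Tstar)
    (hu : ∀ᶠ i in l, (∀ a b, IntervalIntegrable (g i) volume a b) ∧
      IsMaximalNLSSolution σ α (g i) t₀ (sobolevEmb (Nat.cast_nonneg σ) a₀) (Tmax i) (u i))
    (hθ : ∀ r > 0, ∀ᶠ i in l, ∀ t ∈ Icc t₀ T,
      |(∫ τ in t₀..t, g i τ) - ∫ τ in t₀..t, g₀ τ| < r) {η : ℝ} (hη : 0 < η) :
    ∀ᶠ i in l, (T : EReal) < Tmax i ∧
      ∀ t ∈ Icc t₀ T, hsNorm σ (u i t - u₀ t) ≤ ENNReal.ofReal η := by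
  obtain ⟨c, hc, huc⟩ := hu₀.exists_isMaximalIntegralSolution hNl.continuous hN hg₀
  have hθ₀ : Continuous fun r => ∫ τ in t₀..r, g₀ τ := intervalIntegral.continuous_primitive hg₀ t₀
  have hlt : ∀ t ∈ Icc t₀ T, (t : EReal) < Tstar := fun t ht =>
    lt_of_le_of_lt (EReal.coe_le_coe_iff.mpr ht.2) hTstar
  have hcT := hc.isSolution.mono (J' := Icc t₀ T) fun t ht => ⟨ht.1, hlt t ht⟩
  obtain ⟨R, hR⟩ := hcT.exists_norm_le
  obtain ⟨K, hK⟩ := hNl (R + 1)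
  -- Half of `η` is kept for the change of the free flow; the bound 1 is required by
  -- `IsMaximalIntegralSolution.dist_lt`.
  set ρ : ℝ := min (η / 2) 1 with hρ
  have hρ0 : 0 < ρ := by positivity
  obtain ⟨δ, hδ0, hδ⟩ : ∃ δ > 0, gronwallBound 0 K δ (T - t₀) < ρ := by
    have hcont := gronwallBound_continuous_ε 0 K (T - t₀)
    have h0 : gronwallBound 0 K 0 (T - t₀) < ρ := by simpa [gronwallBound_ε0] using hρ0
    have hev := (hcont.tendsto 0).eventually (Iio_mem_nhds h0)
    obtain ⟨δ, h1, h2⟩ := ((hev.filter_mono nhdsWithin_le_nhds).and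
      (self_mem_nhdsWithin (s := Ioi (0 : ℝ)))).exists
    exact ⟨δ, h2, h1⟩
  obtain ⟨r₁, hr₁, h₁⟩ := exists_pos_forall_norm_sub_lt
    (continuous_interactionField isIsometryGroup_schrodingerMul hNl.continuous) isCompact_Icc hθ₀.continuousOn hcT.cont hδ0
  obtain ⟨r₂, hr₂, h₂⟩ := exists_pos_forall_norm_sub_lt (Ψ := fun r x => schrodingerMul (d := d) r x)
    continuous_schrodingerMul isCompact_Icc hθ₀.continuousOn hcT.cont (half_pos hη)
  filter_upwards [hu, hθ r₁ hr₁, hθ r₂ hr₂] with i ⟨hgi, hui⟩ hθ₁ hθ₂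
  obtain ⟨b, hb, hub⟩ := hui.exists_isMaximalIntegralSolution hNl.continuous hN hgi
  have hθi : Continuous fun r => ∫ τ in t₀..r, g i τ := intervalIntegral.continuous_primitive hgi t₀
  obtain ⟨hTi, hbc⟩ := hb.dist_lt (isUniformLipschitzField_interactionField isIsometryGroup_schrodingerMul hNl hθi).cont
    (isUniformLipschitzField_interactionField isIsometryGroup_schrodingerMul hNl hθ₀).cont hT hcT hR
    (fun t => lipschitzOnWith_interactionField isIsometryGroup_schrodingerMul hK _)
    (fun t ht => (h₁ t ht _ (hθ₁ t ht)).le) (min_le_right _ _) hδ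
  refine ⟨hTi, fun t ht => ?_⟩
  rw [hub t ht.1 (lt_of_le_of_lt (EReal.coe_le_coe_iff.mpr ht.2) hTi), huc t ht.1 (hlt t ht),
    hsNorm_sobolevEmb_sub, edist_dist]
  refine ENNReal.ofReal_le_ofReal ?_
  -- The error splits as S(θ_i)(b - c), with the norm of b - c, plus (S(θ_i) - S(θ₀))c.
  have hd₁ : dist (schrodingerMul (∫ τ in t₀..t, g i τ) (b t))
      (schrodingerMul (∫ τ in t₀..t, g i τ) (c t)) < ρ := by
    rw [isIsometryGroup_schrodingerMul.dist_map, dist_eq_norm]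
    exact hbc t ht
  have hd₂ : dist (schrodingerMul (∫ τ in t₀..t, g i τ) (c t))
      (schrodingerMul (∫ τ in t₀..t, g₀ τ) (c t)) < η / 2 := by
    rw [dist_eq_norm]
    exact h₂ t ht _ (hθ₂ t ht)
  linarith [dist_triangle (schrodingerMul (∫ τ in t₀..t, g i τ) (b t))
    (schrodingerMul (∫ τ in t₀..t, g i τ) (c t)) (schrodingerMul (∫ τ in t₀..t, g₀ τ) (c t)),
    min_le_left (η / 2) 1]

end Averaging

theorem mainTheorem6 (d σ α : ℕ) (hd : 1 ≤ d) (hσ : (d : ℝ) / 2 < σ) (hα : 1 ≤ α)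
    (γp γm tp : ℝ) (hγp : 0 < γp) (hγm : 0 < γm) (htp : tp ∈ Set.Ioo (0 : ℝ) 1)
    (t₀ : ℝ) (φ : L2 d) (hφ : MemHs σ φ) :
    HasUniqueMaximalNLSSolution σ α
      (fun _ => averageDispersion (dispersionMap γp γm tp)) t₀ φ ∧
    (∀ ε : ℝ, 0 < ε →
      HasUniqueMaximalNLSSolution σ α (fun t => dispersionMap γp γm tp (t / ε)) t₀ φ) ∧
    ∀ (Tstar : EReal) (u₀ : ℝ → L2 d) (Tmax : ℝ → EReal) (u : ℝ → ℝ → L2 d),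
      IsMaximalNLSSolution σ α
        (fun _ => averageDispersion (dispersionMap γp γm tp)) t₀ φ Tstar u₀ →
      (∀ ε : ℝ, 0 < ε → IsMaximalNLSSolution σ α
        (fun t => dispersionMap γp γm tp (t / ε)) t₀ φ (Tmax ε) (u ε)) →
      ∀ T : ℝ, t₀ < T → (T : EReal) < Tstar →
        (∀ᶠ ε in 𝓝[>] (0 : ℝ), (T : EReal) < Tmax ε) ∧
        Tendsto (fun ε => ⨆ t ∈ Set.Icc t₀ T, hsNorm σ (u ε t - u₀ t))
          (𝓝[>] (0 : ℝ)) (𝓝 0) := by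
  have hds : (d : ℝ) < 2 * (σ : ℝ) := by linarith
  obtain ⟨N, hNl, hN⟩ := exists_powerNL_sobolevEmb (d := d) (Nat.cast_nonneg σ) hds α
  obtain ⟨a₀, rfl⟩ := exists_sobolevEmb_eq (Nat.cast_nonneg σ) hφ
  have hgε : ∀ ε a b, IntervalIntegrable (fun t => dispersionMap γp γm tp (t / ε)) volume a b :=
    fun ε => intervalIntegrable_dispersionMap_comp γp γm tp (measurable_id.div_const ε)
  refine ⟨hasUniqueMaximalNLSSolution_of_isLipschitzOnBalls hNl hN
      fun _ _ => intervalIntegrable_const,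
    fun ε _ => hasUniqueMaximalNLSSolution_of_isLipschitzOnBalls hNl hN (hgε ε), ?_⟩
  intro Tstar u₀ Tmax u hu₀ hu T hT hTstar
  obtain ⟨B, hB⟩ := (periodic_dispersionMap γp γm tp).exists_abs_integral_comp_div_sub_le
    (intervalIntegrable_dispersionMap_comp γp γm tp measurable_id)
  have hlim : Tendsto (fun ε : ℝ => ε * B) (𝓝[>] (0 : ℝ)) (𝓝 0) := by
    have : Tendsto (fun ε : ℝ => ε * B) (𝓝 (0 : ℝ)) (𝓝 (0 * B)) :=
      (continuous_id.mul continuous_const).tendsto 0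
    rw [zero_mul] at this
    exact this.mono_left nhdsWithin_le_nhds
  have key := fun (η : ℝ) (hη : 0 < η) => eventually_hsNorm_sub_le hNl hN (l := 𝓝[>] (0 : ℝ))
    (g := fun ε t => dispersionMap γp γm tp (t / ε)) (fun _ _ => intervalIntegrable_const)
    hT.le hu₀ hTstar
    (eventually_mem_nhdsWithin.mono fun ε hε => ⟨hgε ε, hu ε hε⟩)
    (fun r hr => by
      filter_upwards [self_mem_nhdsWithin, hlim.eventually (Iio_mem_nhds hr)] with ε hε hεr t _
      exact (hB ε hε t₀ t).trans_lt hεr) hη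
  refine ⟨(key 1 one_pos).mono fun ε h => h.1, ?_⟩
  rw [ENNReal.tendsto_nhds_zero]
  intro η hη
  -- The tolerance `η` may be infinite, so a finite positive one below it is used.
  obtain ⟨η', hη'0, hη'⟩ : ∃ η' : ℝ, 0 < η' ∧ ENNReal.ofReal η' ≤ η := by
    obtain ⟨x, hx0, hx⟩ := ENNReal.lt_iff_exists_nnreal_btwn.mp hη
    exact ⟨x, by exact_mod_cast hx0, by simpa using hx.le⟩
  filter_upwards [key η' hη'0] with ε h
  exact iSup₂_le fun t ht => (h.2 t ht).trans hη'
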